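/- Let $1<p<\infty$, $p'=p/(p-1)$ and $t_0>0$. For $1<r,s<\infty$ let $\pi_{r,s}=2\int_0^1(1-t^s)^{-1/r}\,dt$, and let $\sin_{r,s}:\mathbb R\to[-1,1]$ be the odd, $2\pi_{r,s}$-periodic function which is even with respect to $\pi_{r,s}/2$ and which on $[0,\pi_{r,s}/2]$ is the inverse of $y\mapsto\int_0^y(1-t^s)^{-1/r}\,dt$, $y\in[0,1]$. Write $[x]^{r-1}=|x|^{r-2}x$ (with $[0]^{r-1}=0$). An eigenpair is a pair $(u,\lambda)$ with $\lambda>0$ and $u\not\equiv0$ on $[0,t_0]$ such that $u$ and $[u'']^{p-1}$ are of class $C^2$ on $[0,t_0]$ and \[([u'']^{p-1})''=\lambda\,[u]^{p'-1}\ \text{ on }[0,t_0],\qquad u(0)=u(t_0)=u''(0)=u''(t_0)=0 .\] For $c>0$ and an integer $n\ge1$ put \[\lambda_n(c)=\frac{(\pi_{2,p'}\pi_{p,2}n^2)^p}{t_0^{2p}}\,c^{p-p'},\qquad f_{n,c}(x)=c\,\sin_{2,p'}\!\left(\frac{\pi_{2,p'}\,n\,x}{t_0}\right).\] A function changes sign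 exactly $m$ times on $(0,t_0)$ if $m$ is the largest integer for which there are points $x_0<\dots<x_m$ in $(0,t_0)$ at which its values have alternating strict signs. Then: 1. $\lambda_n(c)=\left(\dfrac{p'\pi_{2,p'}^2n^2}{2t_0^2}\right)^p c^{p-p'}$ for all $n\ge1$, $c>0$. 2. For all $n\ge 1$, $c>0$, the pair $(f_{n,c},\lambda_n(c))$ is an eigenpair, $f_{n,c}'(0)>0$, and $f_{n,c}$ changes sign exactly $n-1$ times on $(0,t_0)$. 3. Every eigenpair $(u,\lambda)$ is of the form $(\pm f_{n,c},\lambda_n(c))$ on $[0,t_0]$ for some $n\ge1$, $c>0$. If moreover $u'(0)>0$ and $u$ changes sign exactly $n-1$ times on $(0,t_0)$, then $(u,\lambda)=(f_{n,c},\lambda_n(c))$ for some $c>0$ with this same $n$. 4. If $p\ne2$, then for all $n\ge1$, $c>0$, the function $f_{n,c}$ is the unique eigenfunction for the eigenvalue $\lambda_n(c)$ which has positive derivative at $0$ and changes sign exactly $n-1$ times on $(0,t_0)$. -/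

import Mathlib

open Set

noncomputable section

namespace BiharmonicEigen

/-- The incomplete integral `F_{r,s}(y) = ∫₀^y (1 - t^s)^{-1/r} dt`, for `0 ≤ y ≤ 1`. -/
def arcsinRS (r s y : ℝ) : ℝ := ∫ t in (0 : ℝ)..y, 1 / (1 - t ^ s) ^ (1 / r)

/-- The generalized `π_{r,s} = 2 ∫₀¹ (1 - t^s)^{-1/r} dt`. -/
def piRS (r s : ℝ) : ℝ := 2 * ∫ t in (0 : ℝ)..1, 1 / (1 - t ^ s) ^ (1 / r)

/-- The inverse of `F_{r,s}` on `[0, π_{r,s} / 2]`, with values in `[0, 1]`. -/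
def sinRSBase (r s x : ℝ) : ℝ := Function.invFunOn (arcsinRS r s) (Icc 0 1) x

/-- The representative of `x` modulo `2 π_{r,s}` that lies in `[-π_{r,s}, π_{r,s})`. -/
def redRS (r s x : ℝ) : ℝ := x - 2 * piRS r s * (round (x / (2 * piRS r s)) : ℝ)

/-- The generalized sine `sin_{r,s} : ℝ → [-1, 1]`: the `2 π_{r,s}`-periodic odd function which is
the inverse of `F_{r,s}` on `[0, π_{r,s} / 2]` and is even with respect to `π_{r,s} / 2`. -/
def sinRS (r s x : ℝ) : ℝ :=
  Real.sign (redRS r s x) *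
    sinRSBase r s (min |redRS r s x| (piRS r s - |redRS r s x|))

/-- The signed power `[x]^{r-1} = |x|^{r-2} x` (equal to `0` at `x = 0`). -/
def signedPow (r x : ℝ) : ℝ := |x| ^ (r - 2) * x

/-- `(u, lam)` is an eigenpair on `[0, t0]` of
`([u'']^{p-1})'' = lam [u]^{q-1}`, `u(0) = u(t0) = u''(0) = u''(t0) = 0`,
with `lam > 0` and `u` not identically zero on `[0, t0]`. Derivatives at the two end points
are one-sided, and values of `u` outside `[0, t0]` play no role. -/
structure IsEigenpair (p q t0 : ℝ) (u : ℝ → ℝ) (lam : ℝ) : Prop where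
  lam_pos : 0 < lam
  nontrivial : ∃ t ∈ Icc 0 t0, u t ≠ 0
  contDiffOn : ContDiffOn ℝ 2 u (Icc 0 t0)
  contDiffOn_pow : ContDiffOn ℝ 2
    (fun t => signedPow p (iteratedDerivWithin 2 u (Icc 0 t0) t)) (Icc 0 t0)
  equation : ∀ t ∈ Icc 0 t0,
    iteratedDerivWithin 2 (fun s => signedPow p (iteratedDerivWithin 2 u (Icc 0 t0) s))
      (Icc 0 t0) t = lam * signedPow q (u t)
  left : u 0 = 0
  right : u t0 = 0
  left_second : iteratedDerivWithin 2 u (Icc 0 t0) 0 = 0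
  right_second : iteratedDerivWithin 2 u (Icc 0 t0) t0 = 0

/-- There are points `x 0 < x 1 < ... < x m` in `S` at which `u` takes values of alternating
strict signs. -/
def HasAlternation (u : ℝ → ℝ) (S : Set ℝ) (m : ℕ) : Prop :=
  ∃ x : Fin (m + 1) → ℝ, StrictMono x ∧ (∀ i, x i ∈ S) ∧
    ∀ i : Fin m, u (x i.castSucc) * u (x i.succ) < 0

/-- `u` changes sign exactly `m` times on `S`. -/
def ChangesSignExactly (u : ℝ → ℝ) (S : Set ℝ) (m : ℕ) : Prop :=
  HasAlternation u S m ∧ ¬ HasAlternation u S (m + 1)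

/-- `λ_n(c) = (π_{2,p'} π_{p,2} n²)^p / t0^{2p} * c^{p-p'}`. -/
def eigenvalueN (p p' t0 : ℝ) (n : ℕ) (c : ℝ) : ℝ :=
  (piRS 2 p' * piRS p 2 * (n : ℝ) ^ 2) ^ p / t0 ^ (2 * p) * c ^ (p - p')

/-- `f_{n,c}(x) = c sin_{2,p'}(π_{2,p'} n x / t0)`. -/
def eigenfunctionN (p' t0 : ℝ) (n : ℕ) (c : ℝ) (x : ℝ) : ℝ :=
  c * sinRS 2 p' (piRS 2 p' * n * x / t0)

end BiharmonicEigen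

end

open Set

noncomputable section

namespace BiharmonicEigen

open MeasureTheory Filter Topology

/-! ### The signed power -/

/-! Write `q` for `p'`. The fourth order problem collapses to a second order one. With `w =
[u'']^{p-1}`, `K = λ^{1/p}` and `k = λ^{1/q}`, the functions `u` and `v = -w/k` solve the symmetric
system `u'' = -K[v]^{q-1}`, `v'' = -K[u]^{q-1}` with zero boundary values. The product `(u - v)(u' -
v')` is nondecreasing and vanishes at both ends, so `u = v` (`eqOn_of_symmetric_system`) and `u'' =
-K[u]^{q-1}` (`IsEigenpair.hasDerivWithinAt`). Conversely, such a `u` is an eigenfunction for `K^p`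
(`isEigenpair_of_ode`).

The generalized sine satisfies `S'' = -(q/2)[S]^{q-1}` (`hasDerivAt_deriv_sinRS`), so its rescalings
solve the second order equation. Conservation of energy makes the initial value problem uniquely
solvable for nonzero initial slope, even though `[·]^{q-1}` need not be Lipschitz at `0`
(`eqOn_of_ode`). Hence every solution is `±c S(ωx)`, and the right boundary condition quantizes `ω`.

The index `n` counts half-waves, which sign changes detect (`hasAlternation_eigenfunctionN_iff`).
For `p ≠ 2` the power `c^{p-q}` recovers `c`. -/

lemma signedPow_zero (r : ℝ) : signedPow r 0 = 0 := by simp [signedPow]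

lemma signedPow_neg (r x : ℝ) : signedPow r (-x) = -signedPow r x := by simp [signedPow]

lemma signedPow_of_nonneg {r x : ℝ} (hr : 1 < r) (hx : 0 ≤ x) : signedPow r x = x ^ (r - 1) := by
  rcases hx.eq_or_lt with rfl | hx
  · rw [signedPow_zero, Real.zero_rpow (by linarith)]
  · rw [signedPow, abs_of_pos hx, ← Real.rpow_add_one hx.ne']
    ring_nf

lemma signedPow_mul {r c : ℝ} (hr : 1 < r) (hc : 0 ≤ c) (x : ℝ) :
    signedPow r (c * x) = c ^ (r - 1) * signedPow r x := by
  rw [← signedPow_of_nonneg hr hc, signedPow, signedPow, signedPow, abs_mul,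
    Real.mul_rpow (abs_nonneg _) (abs_nonneg _)]
  ring

lemma strictMono_signedPow {r : ℝ} (hr : 1 < r) : StrictMono (signedPow r) := by
  have hpos : StrictMonoOn (signedPow r) (Ici 0) := fun x hx y hy hxy => by
    rw [signedPow_of_nonneg hr hx, signedPow_of_nonneg hr hy]
    exact Real.rpow_lt_rpow hx hxy (by linarith)
  exact strictMono_of_odd_strictMonoOn_nonneg (signedPow_neg r) hpos

/-- Conjugacy amounts to `(p - 1)(q - 1) = 1`, so the two exponents cancel. -/
lemma signedPow_signedPow {p q : ℝ} (h : p.HolderConjugate q) (x : ℝ) :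
    signedPow p (signedPow q x) = x := by
  have key : ∀ y : ℝ, 0 ≤ y → signedPow p (signedPow q y) = y := fun y hy => by
    rw [signedPow_of_nonneg h.symm.lt hy, signedPow_of_nonneg h.lt (Real.rpow_nonneg hy _),
      ← Real.rpow_mul hy]
    have : (q - 1) * (p - 1) = 1 := by
      have := h.mul_eq_add
      linarith
    rw [this, Real.rpow_one]
  rcases le_total 0 x with hx | hx
  · exact key x hx
  · have := key (-x) (by linarith)
    rw [signedPow_neg, signedPow_neg] at this
    linarith

lemma hasDerivAt_abs_rpow_signedPow {r : ℝ} (hr : 1 < r) (x : ℝ) :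
    HasDerivAt (fun x : ℝ => |x| ^ r) (r * signedPow r x) x := by
  simpa [signedPow, mul_assoc] using hasDerivAt_abs_rpow x hr

lemma contDiff_abs_rpow {r : ℝ} (hr : 1 < r) : ContDiff ℝ 1 (fun x : ℝ => |x| ^ r) := by
  simpa using contDiff_norm_rpow (E := ℝ) hr

/-- For `r < 2` the factor `|x|^(r-2)` is singular at `0`; continuity is read off from the
derivative of the `C¹` function `|x|^r`. -/
lemma continuous_signedPow {r : ℝ} (hr : 1 < r) : Continuous (signedPow r) := by
  have h := (contDiff_abs_rpow hr).continuous_deriv le_rfl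
  have e : deriv (fun x : ℝ => |x| ^ r) = fun x => r * signedPow r x :=
    funext fun x => (hasDerivAt_abs_rpow_signedPow hr x).deriv
  rw [e] at h
  have := h.const_mul r⁻¹
  refine this.congr fun x => ?_
  field_simp

lemma contDiffAt_signedPow (r : ℝ) {x : ℝ} (hx : x ≠ 0) : ContDiffAt ℝ 1 (signedPow r) x := by
  unfold signedPow
  exact ((contDiffAt_abs hx).rpow_const_of_ne (abs_ne_zero.2 hx)).mul contDiffAt_id

/-! ### The incomplete integral -/

lemma integrand_pos {s t : ℝ} (hs : 1 < s) (ht : t ∈ Ioo (0 : ℝ) 1) :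
    0 < 1 - t ^ s := by
  have := Real.rpow_lt_one ht.1.le ht.2 (by linarith : 0 < s)
  linarith

/-- Since `t^s ≤ t` on `[0, 1]`, the integrand is dominated by `(1 - t)^(-1/r)`, integrable because
`1/r < 1`. -/
lemma intervalIntegrable_integrand {r s : ℝ} (hr : 1 < r) (hs : 1 < s) :
    IntervalIntegrable (fun t : ℝ => 1 / (1 - t ^ s) ^ (1 / r)) volume 0 1 := by
  have hr' : 1 / r < 1 := by rw [div_lt_one (by linarith)]; exact hr
  have h1 : IntervalIntegrable (fun t : ℝ => (1 - t) ^ (-(1 / r))) volume 0 1 := by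
    have := (intervalIntegral.intervalIntegrable_rpow' (a := 0) (b := 1)
      (r := -(1 / r)) (by linarith)).comp_sub_left 1
    simpa using this.symm
  refine h1.mono_fun' (by measurability : Measurable fun t : ℝ => 1 / (1 - t ^ s) ^ (1 / r)).aestronglyMeasurable ?_
  rw [uIoc_of_le zero_le_one]
  refine (ae_restrict_iff' measurableSet_Ioc).2 (Eventually.of_forall fun t ht => ?_)
  rcases ht.2.eq_or_lt with rfl | h
  -- At `t = 1` the integrand is `1 / 0 = 0`, so only nonnegativity of the bound matters.
  · simp [Real.zero_rpow (by positivity : r⁻¹ ≠ 0), Real.rpow_nonneg]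
  · have h3 : t ^ s ≤ t := Real.rpow_le_self_of_le_one ht.1.le h.le hs.le
    have h4 : 0 < 1 - t := by linarith
    beta_reduce
    rw [Real.norm_of_nonneg (by have : 0 ≤ 1 - t ^ s := by linarith
                                positivity), Real.rpow_neg h4.le, one_div]
    gcongr

section ArcsinRS

variable {r s : ℝ}

lemma continuousOn_arcsinRS (hr : 1 < r) (hs : 1 < s) :
    ContinuousOn (arcsinRS r s) (Icc 0 1) := by
  have := intervalIntegral.continuousOn_primitive_interval'
    (intervalIntegrable_integrand hr hs) left_mem_uIcc
  rwa [uIcc_of_le zero_le_one] at this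

lemma hasDerivAt_arcsinRS (hr : 1 < r) (hs : 1 < s) {y : ℝ} (hy : y ∈ Ioo (0 : ℝ) 1) :
    HasDerivAt (arcsinRS r s) (1 / (1 - y ^ s) ^ (1 / r)) y := by
  refine intervalIntegral.integral_hasDerivAt_right
    ((intervalIntegrable_integrand hr hs).mono_set ?_) ?_ ?_
  · rw [uIcc_of_le zero_le_one, uIcc_of_le hy.1.le]
    exact Icc_subset_Icc_right hy.2.le
  · exact (by fun_prop : Measurable fun t : ℝ => 1 / (1 - t ^ s) ^ (1 / r))
      |>.stronglyMeasurable.stronglyMeasurableAtFilter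
  · have h := integrand_pos hs hy
    have h2 : ContinuousAt (fun t : ℝ => t ^ s) y :=
      Real.continuousAt_rpow_const _ _ (Or.inl hy.1.ne')
    refine continuousAt_const.div ((continuousAt_const.sub h2).rpow_const (Or.inl h.ne')) ?_
    exact (Real.rpow_pos_of_pos h _).ne'

lemma arcsinRS_zero : arcsinRS r s 0 = 0 := by simp [arcsinRS]

lemma arcsinRS_one : arcsinRS r s 1 = piRS r s / 2 := by simp [arcsinRS, piRS]

lemma strictMonoOn_arcsinRS (hr : 1 < r) (hs : 1 < s) :
    StrictMonoOn (arcsinRS r s) (Icc 0 1) := by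
  refine strictMonoOn_of_deriv_pos (convex_Icc 0 1) (continuousOn_arcsinRS hr hs) fun y hy => ?_
  rw [interior_Icc] at hy
  rw [(hasDerivAt_arcsinRS hr hs hy).deriv]
  have := integrand_pos hs hy
  positivity

lemma piRS_pos (hr : 1 < r) (hs : 1 < s) : 0 < piRS r s := by
  have := strictMonoOn_arcsinRS hr hs (left_mem_Icc.2 zero_le_one)
    (right_mem_Icc.2 zero_le_one) zero_lt_one
  rw [arcsinRS_zero, arcsinRS_one] at this
  linarith

/-- This is the substitution `y = √(1 - x^q)`. To avoid a change of variables in improper integrals,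
the two primitives are combined into `G`, which has zero derivative inside and is continuous up to
the ends; comparing `G 0` with `G 1` gives the identity. -/
lemma piRS_holderConjugate {p q : ℝ} (h : p.HolderConjugate q) :
    piRS p 2 = q / 2 * piRS 2 q := by
  have hp := h.lt
  have hq := h.symm.lt
  set g : ℝ → ℝ := fun x => √(1 - x ^ q) with hg
  have hg01 : ∀ x ∈ Icc (0 : ℝ) 1, g x ∈ Icc (0 : ℝ) 1 := fun x hx =>
    ⟨Real.sqrt_nonneg _, Real.sqrt_le_one.2 (by
      have := Real.rpow_nonneg hx.1 q
      linarith)⟩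
  have hgc : Continuous g := (continuous_const.sub
    (Real.continuous_rpow_const (by linarith))).sqrt
  set G : ℝ → ℝ := fun x => arcsinRS p 2 (g x) + q / 2 * arcsinRS 2 q x with hG
  have hGc : ContinuousOn G (Icc 0 1) :=
    ((continuousOn_arcsinRS hp one_lt_two).comp hgc.continuousOn hg01).add
      (continuousOn_const.mul (continuousOn_arcsinRS one_lt_two hq))
  have hGd : ∀ x ∈ Ioo (0 : ℝ) 1, HasDerivAt G 0 x := fun x hx => by
    have hx1 := integrand_pos hq hx
    have hgx : 0 < g x := Real.sqrt_pos.2 hx1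
    have hxq : 0 < x ^ q := Real.rpow_pos_of_pos hx.1 q
    have hgx1 : g x < 1 := by
      rw [hg, Real.sqrt_lt' one_pos]
      linarith
    have hd : HasDerivAt g (-(q * x ^ (q - 1)) / (2 * √(1 - x ^ q))) x :=
      ((Real.hasDerivAt_rpow_const (Or.inl hx.1.ne')).const_sub 1).sqrt hx1.ne'
    have h1 := ((hasDerivAt_arcsinRS hp one_lt_two ⟨hgx, hgx1⟩).comp x hd).add
      ((hasDerivAt_arcsinRS one_lt_two hq hx).const_mul (q / 2))
    refine h1.congr_deriv ?_
    have e1 : 1 - g x ^ (2 : ℝ) = x ^ q := by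
      rw [Real.rpow_two, Real.sq_sqrt hx1.le]
      ring
    have e2 : (x ^ q) ^ (1 / p) = x ^ (q - 1) := by
      rw [← Real.rpow_mul hx.1.le]
      congr 1
      have := h.mul_eq_add
      field_simp
      linarith
    rw [e1, e2, ← Real.sqrt_eq_rpow]
    have : 0 < x ^ (q - 1) := Real.rpow_pos_of_pos hx.1 _
    have : 0 < √(1 - x ^ q) := hgx
    field_simp
    ring
  obtain ⟨x, hx, hxe⟩ := exists_hasDerivAt_eq_slope G (fun _ => 0) zero_lt_one hGc hGd
  have : G 1 = G 0 := by
    simp only [sub_zero, div_one] at hxe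
    linarith
  have g0 : g 0 = 1 := by simp [hg, Real.zero_rpow (by linarith : q ≠ 0)]
  have g1 : g 1 = 0 := by simp [hg]
  simp only [hG, g0, g1, arcsinRS_zero, arcsinRS_one] at this
  linarith

end ArcsinRS

/-! ### The generalized sine: inverse property and symmetries -/

section Sine

variable {r s : ℝ}

lemma sinRSBase_mem (hr : 1 < r) (hs : 1 < s) {x : ℝ} (hx : x ∈ Icc 0 (piRS r s / 2)) :
    sinRSBase r s x ∈ Icc (0 : ℝ) 1 ∧ arcsinRS r s (sinRSBase r s x) = x := by
  have : x ∈ arcsinRS r s '' Icc 0 1 := by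
    apply intermediate_value_Icc zero_le_one (continuousOn_arcsinRS hr hs)
    rwa [arcsinRS_zero, arcsinRS_one]
  exact Function.invFunOn_pos this

lemma sinRSBase_arcsinRS (hr : 1 < r) (hs : 1 < s) {y : ℝ} (hy : y ∈ Icc (0 : ℝ) 1) :
    sinRSBase r s (arcsinRS r s y) = y :=
  (strictMonoOn_arcsinRS hr hs).injOn.leftInvOn_invFunOn hy

lemma sinRSBase_zero (hr : 1 < r) (hs : 1 < s) : sinRSBase r s 0 = 0 := by
  have := sinRSBase_arcsinRS hr hs (left_mem_Icc.2 zero_le_one)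
  rwa [arcsinRS_zero] at this

lemma sinRSBase_piRS_div_two (hr : 1 < r) (hs : 1 < s) :
    sinRSBase r s (piRS r s / 2) = 1 := by
  have := sinRSBase_arcsinRS hr hs (right_mem_Icc.2 zero_le_one)
  rwa [arcsinRS_one] at this

lemma strictMonoOn_sinRSBase (hr : 1 < r) (hs : 1 < s) :
    StrictMonoOn (sinRSBase r s) (Icc 0 (piRS r s / 2)) := fun x hx y hy hxy => by
  obtain ⟨hx1, hx2⟩ := sinRSBase_mem hr hs hx
  obtain ⟨hy1, hy2⟩ := sinRSBase_mem hr hs hy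
  rw [← (strictMonoOn_arcsinRS hr hs).lt_iff_lt hx1 hy1, hx2, hy2]
  exact hxy

lemma sinRSBase_mem_Ioo (hr : 1 < r) (hs : 1 < s) {x : ℝ} (hx : x ∈ Ioo 0 (piRS r s / 2)) :
    sinRSBase r s x ∈ Ioo (0 : ℝ) 1 := by
  have h := hx.1.trans hx.2
  have m := strictMonoOn_sinRSBase hr hs
  constructor
  · rw [← sinRSBase_zero hr hs]
    exact m (left_mem_Icc.2 h.le) (Ioo_subset_Icc_self hx) hx.1
  · rw [← sinRSBase_piRS_div_two hr hs]
    exact m (Ioo_subset_Icc_self hx) (right_mem_Icc.2 h.le) hx.2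

/-- The inverse of a continuous injection on a compact set is continuous: preimages of closed sets
are images of compact ones. -/
lemma continuousOn_sinRSBase (hr : 1 < r) (hs : 1 < s) :
    ContinuousOn (sinRSBase r s) (Icc 0 (piRS r s / 2)) := by
  rw [continuousOn_iff_isClosed]
  intro t ht
  refine ⟨arcsinRS r s '' (Icc 0 1 ∩ t), ?_, ?_⟩
  · exact ((isCompact_Icc.inter_right ht).image_of_continuousOn
      ((continuousOn_arcsinRS hr hs).mono inter_subset_left)).isClosed
  · ext x
    constructor
    · rintro ⟨hxt, hx⟩
      obtain ⟨h1, h2⟩ := sinRSBase_mem hr hs hx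
      exact ⟨⟨_, ⟨h1, hxt⟩, h2⟩, hx⟩
    · rintro ⟨⟨y, ⟨hy, hyt⟩, rfl⟩, hx⟩
      refine ⟨?_, hx⟩
      rwa [mem_preimage, sinRSBase_arcsinRS hr hs hy]

lemma redRS_eq (hr : 1 < r) (hs : 1 < s) {x : ℝ} (k : ℤ)
    (hx : x - 2 * piRS r s * k ∈ Ico (-piRS r s) (piRS r s)) :
    redRS r s x = x - 2 * piRS r s * k := by
  have hP := piRS_pos hr hs
  have : round (x / (2 * piRS r s)) = k := by
    rw [round_eq, Int.floor_eq_iff]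
    have h1 := hx.1
    have h2 := hx.2
    constructor
    · rw [← sub_le_iff_le_add, le_div_iff₀ (by positivity)]
      linarith
    · rw [← lt_sub_iff_add_lt, div_lt_iff₀ (by positivity)]
      linarith
  rw [redRS, this]

lemma redRS_add_period (hr : 1 < r) (hs : 1 < s) (x : ℝ) :
    redRS r s (x + 2 * piRS r s) = redRS r s x := by
  have hP := piRS_pos hr hs
  have : (x + 2 * piRS r s) / (2 * piRS r s) = x / (2 * piRS r s) + 1 := by field_simp
  rw [redRS, redRS, this, round_add_one]
  push_cast
  ring

lemma redRS_mem (hr : 1 < r) (hs : 1 < s) (x : ℝ) :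
    redRS r s x ∈ Ico (-piRS r s) (piRS r s) := by
  have hP := piRS_pos hr hs
  have h := Int.floor_eq_iff.1 (round_eq (x / (2 * piRS r s))).symm
  obtain ⟨h1, h2⟩ := h
  rw [← sub_le_iff_le_add, le_div_iff₀ (by positivity)] at h1
  rw [← lt_sub_iff_add_lt, div_lt_iff₀ (by positivity)] at h2
  rw [redRS]
  constructor <;> linarith

lemma sinRS_add_period (hr : 1 < r) (hs : 1 < s) (x : ℝ) :
    sinRS r s (x + 2 * piRS r s) = sinRS r s x := by
  rw [sinRS, sinRS, redRS_add_period hr hs]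

lemma sinRS_of_mem (hr : 1 < r) (hs : 1 < s) {x : ℝ} (hx : x ∈ Icc 0 (piRS r s)) :
    sinRS r s x = sinRSBase r s (min x (piRS r s - x)) := by
  have hP := piRS_pos hr hs
  rcases hx.2.eq_or_lt with h | h
  -- `round` sends halves upwards, so `π` reduces to `-π`; the base function vanishes there, so the
  -- sign is harmless.
  · have : redRS r s x = -piRS r s := by
      rw [redRS_eq hr hs 1 ⟨by push_cast; linarith, by push_cast; linarith⟩]
      push_cast
      linarith
    rw [sinRS, this, h, abs_neg, abs_of_pos hP, sub_self, min_eq_right hP.le,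
      sinRSBase_zero hr hs, mul_zero]
  · have : redRS r s x = x := by
      rw [redRS_eq hr hs 0 ⟨by push_cast; linarith [hx.1], by push_cast; linarith⟩]
      simp
    rw [sinRS, this, abs_of_nonneg hx.1]
    rcases hx.1.eq_or_lt with h0 | h0
    · rw [← h0, sub_zero, min_eq_left hP.le, sinRSBase_zero hr hs, mul_zero]
    · rw [Real.sign_of_pos h0, one_mul]

lemma sinRS_neg_of_mem (hr : 1 < r) (hs : 1 < s) {x : ℝ} (hx : x ∈ Icc 0 (piRS r s)) :
    sinRS r s (-x) = -sinRSBase r s (min x (piRS r s - x)) := by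
  have hP := piRS_pos hr hs
  have : redRS r s (-x) = -x := by
    rw [redRS_eq hr hs 0 ⟨by push_cast; linarith [hx.2], by push_cast; linarith [hx.1]⟩]
    simp
  rw [sinRS, this, abs_neg, abs_of_nonneg hx.1]
  rcases hx.1.eq_or_lt with h0 | h0
  · rw [← h0, sub_zero, min_eq_left hP.le, sinRSBase_zero hr hs, mul_zero, neg_zero]
  · rw [Real.sign_of_neg (by linarith), neg_one_mul]

lemma sinRS_sub_int (hr : 1 < r) (hs : 1 < s) (x : ℝ) (k : ℤ) :
    sinRS r s (x - k * (2 * piRS r s)) = sinRS r s x :=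
  (show Function.Periodic (sinRS r s) (2 * piRS r s) from sinRS_add_period hr hs).sub_int_mul_eq k

lemma exists_reduced (hr : 1 < r) (hs : 1 < s) (x : ℝ) :
    ∃ k : ℤ, x - k * (2 * piRS r s) ∈ Ico (-piRS r s) (piRS r s) := by
  refine ⟨round (x / (2 * piRS r s)), ?_⟩
  have := redRS_mem hr hs x
  rwa [redRS, mul_comm] at this

lemma sinRS_neg (hr : 1 < r) (hs : 1 < s) (x : ℝ) : sinRS r s (-x) = -sinRS r s x := by
  obtain ⟨k, hk⟩ := exists_reduced hr hs x
  have e : sinRS r s (-x) = sinRS r s (-(x - k * (2 * piRS r s))) := by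
    rw [← sinRS_sub_int hr hs (-x) (-k)]
    congr 1
    push_cast
    ring
  rw [e, ← sinRS_sub_int hr hs x k]
  generalize x - k * (2 * piRS r s) = y at hk
  rcases le_total 0 y with h | h
  · rw [sinRS_neg_of_mem hr hs ⟨h, hk.2.le⟩, sinRS_of_mem hr hs ⟨h, hk.2.le⟩]
  · have hy : -y ∈ Icc 0 (piRS r s) := ⟨by linarith, by linarith [hk.1]⟩
    have h1 := sinRS_neg_of_mem hr hs hy
    rw [neg_neg] at h1
    rw [h1, sinRS_of_mem hr hs hy, neg_neg]

lemma sinRS_piRS_sub (hr : 1 < r) (hs : 1 < s) (x : ℝ) :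
    sinRS r s (piRS r s - x) = sinRS r s x := by
  have key : ∀ y ∈ Icc 0 (piRS r s), sinRS r s (piRS r s - y) = sinRS r s y := fun y hy => by
    rw [sinRS_of_mem hr hs hy, sinRS_of_mem hr hs ⟨by linarith [hy.2], by linarith [hy.1]⟩,
      sub_sub_cancel, min_comm]
  obtain ⟨k, hk⟩ := exists_reduced hr hs x
  have e : sinRS r s (piRS r s - x) = sinRS r s (piRS r s - (x - k * (2 * piRS r s))) := by
    rw [← sinRS_sub_int hr hs (piRS r s - x) (-k)]
    congr 1
    push_cast
    ring
  rw [e, ← sinRS_sub_int hr hs x k]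
  generalize x - k * (2 * piRS r s) = y at hk
  rcases le_total 0 y with h | h
  · exact key y ⟨h, hk.2.le⟩
  · have h1 := key (-y) ⟨by linarith, by linarith [hk.1]⟩
    rw [sub_neg_eq_add, sinRS_neg hr hs y] at h1
    have h2 := sinRS_neg hr hs (-piRS r s - y)
    have h3 := sinRS_add_period hr hs (-piRS r s - y)
    rw [show -(-piRS r s - y) = piRS r s + y by ring] at h2
    rw [show -piRS r s - y + 2 * piRS r s = piRS r s - y by ring] at h3
    rw [h3, ← neg_eq_iff_eq_neg.2 h2, h1, neg_neg]

lemma sinRS_add_piRS (hr : 1 < r) (hs : 1 < s) (x : ℝ) :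
    sinRS r s (x + piRS r s) = -sinRS r s x := by
  rw [← sinRS_neg hr hs, ← sinRS_piRS_sub hr hs (-x), sub_neg_eq_add, add_comm]

lemma sinRS_eq_base (hr : 1 < r) (hs : 1 < s) {x : ℝ} (hx : x ∈ Icc 0 (piRS r s / 2)) :
    sinRS r s x = sinRSBase r s x := by
  have hP := piRS_pos hr hs
  rw [sinRS_of_mem hr hs ⟨hx.1, by linarith [hx.2]⟩, min_eq_left (by linarith [hx.2])]

lemma sinRS_zero (hr : 1 < r) (hs : 1 < s) : sinRS r s 0 = 0 := by
  have hP := piRS_pos hr hs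
  rw [sinRS_eq_base hr hs ⟨le_rfl, by positivity⟩, sinRSBase_zero hr hs]

lemma sinRS_piRS_div_two (hr : 1 < r) (hs : 1 < s) : sinRS r s (piRS r s / 2) = 1 := by
  have hP := piRS_pos hr hs
  rw [sinRS_eq_base hr hs ⟨by positivity, le_rfl⟩, sinRSBase_piRS_div_two hr hs]

lemma sinRS_pos (hr : 1 < r) (hs : 1 < s) {x : ℝ} (hx : x ∈ Ioo 0 (piRS r s)) :
    0 < sinRS r s x := by
  have key : ∀ y ∈ Ioc 0 (piRS r s / 2), 0 < sinRS r s y := fun y hy => by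
    rw [sinRS_eq_base hr hs ⟨hy.1.le, hy.2⟩, ← sinRSBase_zero hr hs]
    exact strictMonoOn_sinRSBase hr hs ⟨le_rfl, hy.1.le.trans hy.2⟩ ⟨hy.1.le, hy.2⟩ hy.1
  rcases le_total x (piRS r s / 2) with h | h
  · exact key x ⟨hx.1, h⟩
  · rw [← sinRS_piRS_sub hr hs]
    exact key _ ⟨by linarith [hx.2], by linarith⟩

lemma sinRS_add_nat_mul (hr : 1 < r) (hs : 1 < s) (x : ℝ) (k : ℕ) :
    sinRS r s (x + k * piRS r s) = (-1) ^ k * sinRS r s x := by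
  induction k with
  | zero => simp
  | succ k ih =>
    rw [show x + (k + 1 : ℕ) * piRS r s = x + k * piRS r s + piRS r s by push_cast; ring,
      sinRS_add_piRS hr hs, ih]
    ring

lemma exists_nat_mul_of_sinRS_eq_zero (hr : 1 < r) (hs : 1 < s) {x : ℝ} (hx : 0 ≤ x)
    (h : sinRS r s x = 0) : ∃ k : ℕ, x = k * piRS r s := by
  have hP := piRS_pos hr hs
  refine ⟨⌊x / piRS r s⌋₊, ?_⟩
  have h1 := (le_div_iff₀ hP).1 (Nat.floor_le (div_nonneg hx hP.le))
  have h2 := (div_lt_iff₀ hP).1 (Nat.lt_floor_add_one (x / piRS r s))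
  by_contra hne
  have h3 := sinRS_add_nat_mul hr hs (x - ⌊x / piRS r s⌋₊ * piRS r s) ⌊x / piRS r s⌋₊
  rw [sub_add_cancel, h] at h3
  have h4 := sinRS_pos hr hs (x := x - ⌊x / piRS r s⌋₊ * piRS r s)
    ⟨sub_pos.2 (lt_of_le_of_ne h1 (Ne.symm hne)), by linarith⟩
  have : (-1 : ℝ) ^ ⌊x / piRS r s⌋₊ ≠ 0 := by positivity
  exact (mul_ne_zero this h4.ne') h3.symm

end Sine

/-! ### The generalized sine: derivatives -/

section SineDeriv

/-- A limit of derivatives is a one-sided derivative. This covers the ends of the quarter period,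
where the formulas from the open interval do not apply directly. -/
lemma hasDerivWithinAt_Ici_left_of_Ioo {f g : ℝ → ℝ} {a b : ℝ} (hab : a < b)
    (hf : ContinuousOn f (Icc a b)) (hg : ContinuousOn g (Icc a b))
    (h : ∀ x ∈ Ioo a b, HasDerivAt f (g x) x) : HasDerivWithinAt f (g a) (Ici a) a := by
  refine hasDerivWithinAt_Ici_of_tendsto_deriv (s := Ioo a b)
    (fun x hx => (h x hx).differentiableAt.differentiableWithinAt)
    ((hf a (left_mem_Icc.2 hab.le)).mono Ioo_subset_Icc_self) (Ioo_mem_nhdsGT hab) ?_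
  have h1 : Tendsto g (𝓝[>] a) (𝓝 (g a)) := by
    rw [← nhdsWithin_Ioo_eq_nhdsGT hab]
    exact (hg a (left_mem_Icc.2 hab.le)).mono Ioo_subset_Icc_self
  refine h1.congr' ?_
  filter_upwards [Ioo_mem_nhdsGT hab] with x hx
  exact (h x hx).deriv.symm

lemma hasDerivWithinAt_Iic_right_of_Ioo {f g : ℝ → ℝ} {a b : ℝ} (hab : a < b)
    (hf : ContinuousOn f (Icc a b)) (hg : ContinuousOn g (Icc a b))
    (h : ∀ x ∈ Ioo a b, HasDerivAt f (g x) x) : HasDerivWithinAt f (g b) (Iic b) b := by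
  refine hasDerivWithinAt_Iic_of_tendsto_deriv (s := Ioo a b)
    (fun x hx => (h x hx).differentiableAt.differentiableWithinAt)
    ((hf b (right_mem_Icc.2 hab.le)).mono Ioo_subset_Icc_self) (Ioo_mem_nhdsLT hab) ?_
  have h1 : Tendsto g (𝓝[<] b) (𝓝 (g b)) := by
    rw [← nhdsWithin_Ioo_eq_nhdsLT hab]
    exact (hg b (right_mem_Icc.2 hab.le)).mono Ioo_subset_Icc_self
  refine h1.congr' ?_
  filter_upwards [Ioo_mem_nhdsLT hab] with x hx
  exact (h x hx).deriv.symm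

lemma hasDerivWithinAt_reflect {f : ℝ → ℝ} {a c d x : ℝ} {s t : Set ℝ}
    (hf : ∀ y, f (a - y) = c * f y) (h : HasDerivWithinAt f d s x)
    (hst : MapsTo (fun y => a - y) t s) :
    HasDerivWithinAt (fun y => c * f y) (-d) t (a - x) := by
  have h1 : HasDerivWithinAt (fun y => a - y) (-1) t (a - x) :=
    ((hasDerivAt_id (a - x)).const_sub a).hasDerivWithinAt
  have h2 : HasDerivWithinAt f d s (a - (a - x)) := by rwa [sub_sub_cancel]
  have h3 := h2.scomp (a - x) h1 hst
  exact (h3.congr (fun y _ => (hf y).symm) (hf _).symm).congr_deriv (by simp)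

lemma hasDerivAt_reflect {f : ℝ → ℝ} {a c d x : ℝ} (hc : c * c = 1)
    (hf : ∀ y, f (a - y) = c * f y) (h : HasDerivAt f d x) :
    HasDerivAt f (-(c * d)) (a - x) := by
  have h1 := hasDerivWithinAt_reflect hf h.hasDerivWithinAt (mapsTo_univ _ univ)
  rw [hasDerivWithinAt_univ] at h1
  have h2 := h1.const_mul c
  refine (h2.congr_deriv (by ring)).congr_of_eventuallyEq (Eventually.of_forall fun y => ?_)
  show f y = c * (c * f y)
  rw [← mul_assoc, hc, one_mul]

/-- The symmetry about `a` turns the right derivative `d` into the left derivative `-(c * d)`; `hd`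
says that the two agree. -/
lemma hasDerivAt_of_reflect_Ici {f : ℝ → ℝ} {a c d : ℝ} (hc : c * c = 1)
    (hf : ∀ y, f (a + a - y) = c * f y) (hd : -(c * d) = d)
    (h : HasDerivWithinAt f d (Ici a) a) : HasDerivAt f d a := by
  have h1 := hasDerivWithinAt_reflect (t := Iic a) hf h fun y hy => by
    simp only [mem_Iic, mem_Ici] at *
    linarith
  rw [add_sub_cancel_right] at h1
  have h2 := (h1.const_mul c).congr_deriv (show c * -d = d by linarith)
  have h3 : HasDerivWithinAt f d (Iic a) a := h2.congr_of_eventuallyEq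
    (Eventually.of_forall fun y => by simp [← mul_assoc, hc]) (by simp [← mul_assoc, hc])
  have := h3.union h
  rwa [Iic_union_Ici, hasDerivWithinAt_univ] at this

lemma hasDerivAt_of_reflect_Iic {f : ℝ → ℝ} {a c d : ℝ} (hc : c * c = 1)
    (hf : ∀ y, f (a + a - y) = c * f y) (hd : -(c * d) = d)
    (h : HasDerivWithinAt f d (Iic a) a) : HasDerivAt f d a := by
  have h1 := hasDerivWithinAt_reflect (t := Ici a) hf h fun y hy => by
    simp only [mem_Iic, mem_Ici] at *
    linarith
  rw [add_sub_cancel_right] at h1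
  have h2 := (h1.const_mul c).congr_deriv (show c * -d = d by linarith)
  have h3 : HasDerivWithinAt f d (Ici a) a := h2.congr_of_eventuallyEq
    (Eventually.of_forall fun y => by simp [← mul_assoc, hc]) (by simp [← mul_assoc, hc])
  have := h.union h3
  rwa [Iic_union_Ici, hasDerivWithinAt_univ] at this

/-- The two reflections generate a group containing translation by `P`, and `[0, P/2]` meets every
orbit. -/
lemma forall_of_reflections {P : ℝ} (hP : 0 < P) {Q : ℝ → Prop} (hneg : ∀ x, Q x → Q (-x))
    (hsub : ∀ x, Q x → Q (P - x)) (h : ∀ x ∈ Icc 0 (P / 2), Q x) (x : ℝ) : Q x := by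
  have h1 : ∀ x ∈ Icc 0 P, Q x := fun x hx => by
    rcases le_total x (P / 2) with h2 | h2
    · exact h x ⟨hx.1, h2⟩
    · have := hsub _ (h (P - x) ⟨by linarith [hx.2], by linarith⟩)
      rwa [sub_sub_cancel] at this
  have hadd : ∀ x, Q x → Q (x + P) := fun x hx => by
    have := hsub _ (hneg _ hx)
    rwa [sub_neg_eq_add, add_comm] at this
  have hper : Function.Periodic Q P := fun x => by
    refine propext ⟨fun hx => ?_, hadd x⟩
    have := hneg _ (hsub _ hx)
    rwa [show -(P - (x + P)) = x by ring] at this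
  obtain ⟨y, hy, hxy⟩ := hper.exists_mem_Ico₀ hP x
  rw [hxy]
  exact h1 y (Ico_subset_Icc_self hy)

variable {q : ℝ}

lemma continuousOn_sinRS {r s : ℝ} (hr : 1 < r) (hs : 1 < s) :
    ContinuousOn (sinRS r s) (Icc 0 (piRS r s / 2)) :=
  (continuousOn_sinRSBase hr hs).congr fun _ hx => sinRS_eq_base hr hs hx

lemma hasDerivAt_sinRS_of_mem_Ioo (hq : 1 < q) {x : ℝ} (hx : x ∈ Ioo 0 (piRS 2 q / 2)) :
    HasDerivAt (sinRS 2 q) (√(1 - |sinRS 2 q x| ^ q)) x := by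
  have hb := sinRSBase_mem_Ioo one_lt_two hq hx
  have hpos := integrand_pos hq hb
  have hnear : ∀ᶠ y in 𝓝 x, y ∈ Icc 0 (piRS 2 q / 2) := Icc_mem_nhds hx.1 hx.2
  have h1 := HasDerivAt.of_local_left_inverse
    ((continuousOn_sinRSBase one_lt_two hq).continuousAt (Icc_mem_nhds hx.1 hx.2))
    (hasDerivAt_arcsinRS one_lt_two hq hb) (by positivity)
    (hnear.mono fun y hy => (sinRSBase_mem one_lt_two hq hy).2)
  refine (h1.congr_deriv ?_).congr_of_eventuallyEq
    (hnear.mono fun y hy => sinRS_eq_base one_lt_two hq hy)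
  rw [sinRS_eq_base one_lt_two hq (Ioo_subset_Icc_self hx), abs_of_pos hb.1,
    Real.sqrt_eq_rpow, one_div, inv_inv]

lemma continuousOn_cosRS (hq : 1 < q) :
    ContinuousOn (fun x => √(1 - |sinRS 2 q x| ^ q)) (Icc 0 (piRS 2 q / 2)) :=
  (continuousOn_const.sub ((contDiff_abs_rpow hq).continuous.comp_continuousOn
    (continuousOn_sinRS one_lt_two hq))).sqrt

lemma hasDerivAt_sinRS_of_mem (hq : 1 < q) {x : ℝ} (hx : x ∈ Icc 0 (piRS 2 q / 2)) :
    HasDerivAt (sinRS 2 q) (√(1 - |sinRS 2 q x| ^ q)) x := by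
  have hP : 0 < piRS 2 q / 2 := half_pos (piRS_pos one_lt_two hq)
  have hS := continuousOn_sinRS one_lt_two hq
  have hC := continuousOn_cosRS hq
  have hd := fun x hx => hasDerivAt_sinRS_of_mem_Ioo hq (x := x) hx
  rcases hx.1.eq_or_lt with h0 | h0
  · rw [← h0]
    refine hasDerivAt_of_reflect_Ici (c := -1) (by norm_num) (fun y => ?_) (by ring)
      (hasDerivWithinAt_Ici_left_of_Ioo hP hS hC hd)
    rw [add_zero, zero_sub, sinRS_neg one_lt_two hq, neg_one_mul]
  rcases hx.2.eq_or_lt with h1 | h1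
  · rw [h1]
    refine hasDerivAt_of_reflect_Iic (c := 1) (by norm_num) (fun y => ?_) ?_
      (hasDerivWithinAt_Iic_right_of_Ioo hP hS hC hd)
    · rw [add_halves, sinRS_piRS_sub one_lt_two hq, one_mul]
    · simp [sinRS_piRS_div_two one_lt_two hq]
  · exact hd x ⟨h0, h1⟩

lemma hasDerivAt_sinRS (hq : 1 < q) (x : ℝ) :
    HasDerivAt (sinRS 2 q) (deriv (sinRS 2 q) x) x := by
  rw [hasDerivAt_deriv_iff]
  refine forall_of_reflections (piRS_pos one_lt_two hq) (fun x hx => ?_) (fun x hx => ?_)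
    (fun x hx => (hasDerivAt_sinRS_of_mem hq hx).differentiableAt) x
  · have := hasDerivAt_reflect (a := 0) (c := -1) (by norm_num)
      (fun y => by rw [zero_sub, sinRS_neg one_lt_two hq, neg_one_mul]) hx.hasDerivAt
    rw [zero_sub] at this
    exact this.differentiableAt
  · exact (hasDerivAt_reflect (c := 1) (by norm_num)
      (fun y => by rw [sinRS_piRS_sub one_lt_two hq, one_mul]) hx.hasDerivAt).differentiableAt

lemma deriv_sinRS_neg (hq : 1 < q) (x : ℝ) :
    deriv (sinRS 2 q) (-x) = deriv (sinRS 2 q) x := by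
  have := hasDerivAt_reflect (a := 0) (c := -1) (by norm_num)
    (fun y => by rw [zero_sub, sinRS_neg one_lt_two hq, neg_one_mul]) (hasDerivAt_sinRS hq x)
  rw [zero_sub] at this
  rw [this.deriv]
  ring

lemma deriv_sinRS_piRS_sub (hq : 1 < q) (x : ℝ) :
    deriv (sinRS 2 q) (piRS 2 q - x) = -deriv (sinRS 2 q) x := by
  have := hasDerivAt_reflect (c := 1) (by norm_num)
    (fun y => by rw [sinRS_piRS_sub one_lt_two hq, one_mul]) (hasDerivAt_sinRS hq x)
  rw [this.deriv, one_mul]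

lemma deriv_sinRS_zero (hq : 1 < q) : deriv (sinRS 2 q) 0 = 1 := by
  have hP : 0 < piRS 2 q / 2 := half_pos (piRS_pos one_lt_two hq)
  rw [(hasDerivAt_sinRS_of_mem hq ⟨le_rfl, hP.le⟩).deriv, sinRS_zero one_lt_two hq, abs_zero,
    Real.zero_rpow (by linarith), sub_zero, Real.sqrt_one]

/-- Inside the quarter period, differentiating `√(1 - S^q)` produces `S'` in both numerator and
denominator. After cancellation the formula is continuous up to the ends, so the gluing lemmas and
the reflections extend it to the line. -/
lemma hasDerivAt_deriv_sinRS (hq : 1 < q) (x : ℝ) :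
    HasDerivAt (deriv (sinRS 2 q)) (-(q / 2) * signedPow q (sinRS 2 q x)) x := by
  have hP : 0 < piRS 2 q / 2 := half_pos (piRS_pos one_lt_two hq)
  have heq : ∀ x ∈ Icc 0 (piRS 2 q / 2), deriv (sinRS 2 q) x = √(1 - |sinRS 2 q x| ^ q) :=
    fun x hx => (hasDerivAt_sinRS_of_mem hq hx).deriv
  have hC : ContinuousOn (deriv (sinRS 2 q)) (Icc 0 (piRS 2 q / 2)) :=
    (continuousOn_cosRS hq).congr heq
  have hD : ContinuousOn (fun x => -(q / 2) * signedPow q (sinRS 2 q x))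
      (Icc 0 (piRS 2 q / 2)) :=
    continuousOn_const.mul ((continuous_signedPow hq).comp_continuousOn
      (continuousOn_sinRS one_lt_two hq))
  have hd : ∀ x ∈ Ioo 0 (piRS 2 q / 2),
      HasDerivAt (deriv (sinRS 2 q)) (-(q / 2) * signedPow q (sinRS 2 q x)) x := fun x hx => by
    have hb := sinRSBase_mem_Ioo one_lt_two hq hx
    have hpos := integrand_pos hq hb
    rw [← abs_of_pos hb.1, ← sinRS_eq_base one_lt_two hq (Ioo_subset_Icc_self hx)] at hpos
    have h1 := (((hasDerivAt_abs_rpow_signedPow hq (sinRS 2 q x)).comp x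
      (hasDerivAt_sinRS_of_mem_Ioo hq hx)).const_sub 1).sqrt hpos.ne'
    refine (h1.congr_deriv ?_).congr_of_eventuallyEq ?_
    · have : 0 < √(1 - |sinRS 2 q x| ^ q) := Real.sqrt_pos.2 hpos
      simp only [Function.comp_apply]
      field_simp
    · filter_upwards [Icc_mem_nhds hx.1 hx.2] with y hy using heq y hy
  refine forall_of_reflections (Q := fun x => HasDerivAt (deriv (sinRS 2 q))
    (-(q / 2) * signedPow q (sinRS 2 q x)) x) (piRS_pos one_lt_two hq) (fun x hx => ?_) (fun x hx => ?_)
    (fun x hx => ?_) x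
  · have := hasDerivAt_reflect (a := 0) (c := 1) (by norm_num)
      (fun y => by rw [zero_sub, deriv_sinRS_neg hq, one_mul]) hx
    rw [zero_sub] at this
    refine this.congr_deriv ?_
    rw [sinRS_neg one_lt_two hq, signedPow_neg]
    ring
  · refine (hasDerivAt_reflect (c := -1) (by norm_num)
      (fun y => by rw [deriv_sinRS_piRS_sub hq, neg_one_mul]) hx).congr_deriv ?_
    rw [sinRS_piRS_sub one_lt_two hq]
    ring
  · rcases hx.1.eq_or_lt with h0 | h0
    · rw [← h0]
      refine hasDerivAt_of_reflect_Ici (c := 1) (by norm_num) (fun y => ?_) ?_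
        (hasDerivWithinAt_Ici_left_of_Ioo hP hC hD hd)
      · rw [add_zero, zero_sub, deriv_sinRS_neg hq, one_mul]
      · simp [sinRS_zero one_lt_two hq, signedPow_zero]
    rcases hx.2.eq_or_lt with h1 | h1
    · rw [h1]
      refine hasDerivAt_of_reflect_Iic (c := -1) (by norm_num) (fun y => ?_) (by ring)
        (hasDerivWithinAt_Iic_right_of_Ioo hP hC hD hd)
      rw [add_halves, deriv_sinRS_piRS_sub hq, neg_one_mul]
    · exact hd x ⟨h0, h1⟩

end SineDeriv

/-! ### The differential equations -/

section ODE

variable {q K T : ℝ} {u u₁ v v₁ : ℝ → ℝ}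

lemma continuousOn_of_hasDerivWithinAt {s : Set ℝ} (h : ∀ x ∈ s, HasDerivWithinAt u (u₁ x) s x) :
    ContinuousOn u s := fun x hx => (h x hx).continuousWithinAt

lemma eq_left_of_hasDerivWithinAt_zero (h : ∀ x ∈ Icc 0 T, HasDerivWithinAt u 0 (Icc 0 T) x)
    {x : ℝ} (hx : x ∈ Icc 0 T) : u x = u 0 := by
  rcases (hx.1.trans hx.2).eq_or_lt with h0 | h0
  · rw [le_antisymm (h0 ▸ hx.2) hx.1]
  · exact constant_of_derivWithin_zero (fun x hx => (h x hx).differentiableWithinAt)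
      (fun x hx => (h x (Ico_subset_Icc_self hx)).derivWithin
        (uniqueDiffOn_Icc h0 x (Ico_subset_Icc_self hx))) x hx

/-- Solutions of the symmetric system `u'' = -K [v]^{q-1}`, `v'' = -K [u]^{q-1}` with zero boundary
values are diagonal. -/
lemma eqOn_of_symmetric_system (hq : 1 < q) (hK : 0 < K)
    (hu : ∀ x ∈ Icc 0 T, HasDerivWithinAt u (u₁ x) (Icc 0 T) x)
    (hu₁ : ∀ x ∈ Icc 0 T, HasDerivWithinAt u₁ (-K * signedPow q (v x)) (Icc 0 T) x)
    (hv : ∀ x ∈ Icc 0 T, HasDerivWithinAt v (v₁ x) (Icc 0 T) x)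
    (hv₁ : ∀ x ∈ Icc 0 T, HasDerivWithinAt v₁ (-K * signedPow q (u x)) (Icc 0 T) x)
    (hu0 : u 0 = 0) (huT : u T = 0) (hv0 : v 0 = 0) (hvT : v T = 0) :
    EqOn u v (Icc 0 T) := by
  intro y hy
  have h0T := hy.1.trans hy.2
  -- Half the derivative of `(u - v)²`. Because the system is crossed, `g' = (u' - v')² + K(u -
  -- v)([u]^{q-1} - [v]^{q-1})`, nonnegative by monotonicity of the signed power.
  set g : ℝ → ℝ := fun x => (u x - v x) * (u₁ x - v₁ x) with hg
  have hgd : ∀ x ∈ Icc 0 T, HasDerivWithinAt g ((u₁ x - v₁ x) * (u₁ x - v₁ x) +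
      (u x - v x) * (-K * signedPow q (v x) - -K * signedPow q (u x))) (Icc 0 T) x :=
    fun x hx => ((hu x hx).sub (hv x hx)).mul ((hu₁ x hx).sub (hv₁ x hx))
  have hmono : MonotoneOn g (Icc 0 T) := by
    refine monotoneOn_of_hasDerivWithinAt_nonneg (convex_Icc 0 T)
      (continuousOn_of_hasDerivWithinAt hgd)
      (fun x hx => (hgd x (interior_subset hx)).mono interior_subset) fun x _ => ?_
    have h1 : 0 ≤ (u x - v x) * (signedPow q (u x) - signedPow q (v x)) := by
      rcases le_total (u x) (v x) with h | h
      · exact mul_nonneg_of_nonpos_of_nonpos (sub_nonpos.2 h)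
          (sub_nonpos.2 ((strictMono_signedPow hq).monotone h))
      · exact mul_nonneg (sub_nonneg.2 h) (sub_nonneg.2 ((strictMono_signedPow hq).monotone h))
    have h2 := mul_nonneg hK.le h1
    nlinarith [mul_self_nonneg (u₁ x - v₁ x)]
  have hg0 : ∀ x ∈ Icc 0 T, g x = 0 := fun x hx => by
    have h1 := hmono (left_mem_Icc.2 h0T) hx hx.1
    have h2 := hmono hx (right_mem_Icc.2 h0T) hx.2
    have h3 : g 0 = 0 := by simp [hg, hu0, hv0]
    have h4 : g T = 0 := by simp [hg, huT, hvT]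
    linarith
  have hsq : ∀ x ∈ Icc 0 T, HasDerivWithinAt (fun x => (u x - v x) * (u x - v x)) 0
      (Icc 0 T) x := fun x hx => by
    have hd := (hu x hx).sub (hv x hx)
    refine (hd.mul hd).congr_deriv ?_
    have := hg0 x hx
    simp only [hg, Pi.sub_apply] at this ⊢
    linarith
  have := eq_left_of_hasDerivWithinAt_zero hsq hy
  simp only [hu0, hv0, sub_zero, mul_zero, mul_self_eq_zero] at this
  linarith

lemma energy_eq (hq : 1 < q) (hu : ∀ x ∈ Icc 0 T, HasDerivWithinAt u (u₁ x) (Icc 0 T) x)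
    (hu₁ : ∀ x ∈ Icc 0 T, HasDerivWithinAt u₁ (-K * signedPow q (u x)) (Icc 0 T) x)
    {x : ℝ} (hx : x ∈ Icc 0 T) :
    u₁ x ^ 2 + 2 * K / q * |u x| ^ q = u₁ 0 ^ 2 + 2 * K / q * |u 0| ^ q := by
  refine eq_left_of_hasDerivWithinAt_zero
    (u := fun x => u₁ x ^ 2 + 2 * K / q * |u x| ^ q) (fun y hy => ?_) hx
  have h1 := (hu₁ y hy).pow 2
  have h2 := (((hasDerivAt_abs_rpow_signedPow hq (u y)).comp_hasDerivWithinAt y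
    (hu y hy)).const_mul (2 * K / q))
  refine (h1.add h2).congr_deriv ?_
  have : q ≠ 0 := by linarith
  field_simp
  push_cast
  ring

/-- Regularity of `V` at one point suffices: both curves stay for a short time in a neighbourhood
where `V` is Lipschitz, and Grönwall uniqueness applies there. -/
lemma eventually_eq_of_lipschitz {E : Type*} [NormedAddCommGroup E] [NormedSpace ℝ E]
    {V : E → E} {f g : ℝ → E} {x : ℝ} (hxT : x < T) (hV : ContDiffAt ℝ 1 V (f x))
    (hf : ContinuousOn f (Icc x T)) (hg : ContinuousOn g (Icc x T)) (hfg : f x = g x)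
    (hf' : ∀ᶠ t in 𝓝[≥] x, HasDerivWithinAt f (V (f t)) (Ici t) t)
    (hg' : ∀ᶠ t in 𝓝[≥] x, HasDerivWithinAt g (V (g t)) (Ici t) t) :
    ∀ᶠ t in 𝓝[≥] x, f t = g t := by
  obtain ⟨L, N, hN, hL⟩ := hV.exists_lipschitzOnWith
  have hx : x ∈ Icc x T := left_mem_Icc.2 hxT.le
  have hIcc : Icc x T ∈ 𝓝[≥] x := Icc_mem_nhdsGE hxT
  have hfN : ∀ᶠ t in 𝓝[≥] x, f t ∈ N := (hf x hx).mono_of_mem_nhdsWithin hIcc hN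
  have hgN : ∀ᶠ t in 𝓝[≥] x, g t ∈ N :=
    (hg x hx).mono_of_mem_nhdsWithin hIcc (hfg ▸ hN)
  have hall := hf'.and (hg'.and (hfN.and (hgN.and hIcc)))
  obtain ⟨y, hxy, hy⟩ := mem_nhdsGE_iff_exists_Icc_subset.1 hall
  have hyT : Icc x y ⊆ Icc x T := fun t ht => (hy ht).2.2.2.2
  have := ODE_solution_unique_of_mem_Icc_right (v := fun _ => V) (s := fun _ => N) (K := L)
    (fun _ _ => hL) (hf.mono hyT) (fun t ht => (hy (Ico_subset_Icc_self ht)).1)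
    (fun t ht => (hy (Ico_subset_Icc_self ht)).2.2.1) (hg.mono hyT)
    (fun t ht => (hy (Ico_subset_Icc_self ht)).2.1)
    (fun t ht => (hy (Ico_subset_Icc_self ht)).2.2.2.1) hfg
  exact mem_of_superset (Icc_mem_nhdsGE hxy) this

/-- Uniqueness for `u'' = -K [u]^{q-1}` away from the rest point. -/
lemma eqOn_of_ode (hq : 1 < q) (hK : 0 < K)
    (hu : ∀ x ∈ Icc 0 T, HasDerivWithinAt u (u₁ x) (Icc 0 T) x)
    (hu₁ : ∀ x ∈ Icc 0 T, HasDerivWithinAt u₁ (-K * signedPow q (u x)) (Icc 0 T) x)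
    (hv : ∀ x ∈ Icc 0 T, HasDerivWithinAt v (v₁ x) (Icc 0 T) x)
    (hv₁ : ∀ x ∈ Icc 0 T, HasDerivWithinAt v₁ (-K * signedPow q (v x)) (Icc 0 T) x)
    (h0 : u 0 = v 0) (h1 : u₁ 0 = v₁ 0) (hne : u₁ 0 ≠ 0) : EqOn u v (Icc 0 T) := by
  have hq0 : 0 < q := by linarith
  set w : ℝ → ℝ × ℝ := fun x => (u x, u₁ x) with hw
  set z : ℝ → ℝ × ℝ := fun x => (v x, v₁ x) with hz
  have hwc : ContinuousOn w (Icc 0 T) :=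
    (continuousOn_of_hasDerivWithinAt hu).prodMk (continuousOn_of_hasDerivWithinAt hu₁)
  have hzc : ContinuousOn z (Icc 0 T) :=
    (continuousOn_of_hasDerivWithinAt hv).prodMk (continuousOn_of_hasDerivWithinAt hv₁)
  suffices h : Icc 0 T ⊆ {x | w x = z x} from fun x hx => congrArg Prod.fst (h hx)
  have hcl : IsClosed ({x | w x = z x} ∩ Icc 0 T) := by
    have := (hwc.prodMk hzc).preimage_isClosed_of_isClosed isClosed_Icc isClosed_diagonal
    rwa [inter_comm] at this
  -- Continuation: the closed set where positions and velocities agree must be extended to the right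
  -- of each of its points.
  refine hcl.Icc_subset_of_forall_mem_nhdsWithin (Prod.ext h0 h1) fun x hx => ?_
  obtain ⟨hxe, hx0, hxT⟩ := hx
  have hxI : x ∈ Icc 0 T := ⟨hx0, hxT.le⟩
  have hsub : Icc x T ⊆ Icc 0 T := Icc_subset_Icc_left hx0
  have hnear : ∀ᶠ t in 𝓝[≥] x, t ∈ Ico x T := Ico_mem_nhdsGE hxT
  have hI : ∀ {f f₁ : ℝ → ℝ}, (∀ x ∈ Icc 0 T, HasDerivWithinAt f (f₁ x) (Icc 0 T) x) →
      ∀ t ∈ Ico x T, HasDerivWithinAt f (f₁ t) (Ici t) t := fun h t ht =>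
    (h t ⟨hx0.trans ht.1, ht.2.le⟩).mono_of_mem_nhdsWithin
      (mem_of_superset (Icc_mem_nhdsGE ht.2) (Icc_subset_Icc_left (hx0.trans ht.1)))
  refine nhdsWithin_mono x Ioi_subset_Ici_self ?_
  -- At a zero of `u` the field may fail to be Lipschitz (`q < 2`). There the energy `A > 0` gives
  -- the first order equation `u' = ±√(A - (2K/q)|u|^q)`, whose right side is `C¹` near `0`.
  -- Elsewhere the planar system itself is `C¹`.
  by_cases hux : u x = 0
  · set A : ℝ := u₁ 0 ^ 2 + 2 * K / q * |u 0| ^ q with hA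
    have hEu : ∀ t ∈ Icc 0 T, u₁ t ^ 2 = A - 2 * K / q * |u t| ^ q := fun t ht => by
      rw [hA, ← energy_eq hq hu hu₁ ht]
      ring
    have hEv : ∀ t ∈ Icc 0 T, v₁ t ^ 2 = A - 2 * K / q * |v t| ^ q := fun t ht => by
      rw [hA, h0, h1, ← energy_eq hq hv hv₁ ht]
      ring
    have hApos : 0 < A := by positivity
    have hu₁x : u₁ x ≠ 0 := by
      intro h
      have := hEu x hxI
      rw [h, hux, abs_zero, Real.zero_rpow hq0.ne'] at this
      linarith
    -- `c` is the sign of the common velocity at `x`; it selects the branch of the square root.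
    obtain ⟨c, hc, hcpos⟩ : ∃ c : ℝ, c * c = 1 ∧ 0 < c * u₁ x := by
      rcases lt_or_gt_of_ne hu₁x with h | h
      · exact ⟨-1, by norm_num, by linarith⟩
      · exact ⟨1, by norm_num, by linarith⟩
    set V : ℝ → ℝ := fun y => c * √(A - 2 * K / q * |y| ^ q) with hV
    have hVd : ContDiffAt ℝ 1 V (u x) := by
      refine contDiffAt_const.mul (ContDiffAt.sqrt (contDiffAt_const.sub
        (contDiffAt_const.mul (contDiff_abs_rpow hq).contDiffAt)) ?_)
      rw [hux, abs_zero, Real.zero_rpow hq0.ne']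
      simpa using hApos.ne'
    have hVeq : ∀ {a b : ℝ}, 0 < c * a → a ^ 2 = A - 2 * K / q * |b| ^ q → a = V b := by
      intro a b h1 h2
      have : a ^ 2 = (c * a) ^ 2 := by linear_combination (-a ^ 2) * hc
      show a = c * √(A - 2 * K / q * |b| ^ q)
      rw [← h2, this, Real.sqrt_sq h1.le, ← mul_assoc, hc, one_mul]
    have hpos : ∀ {a : ℝ → ℝ}, ContinuousOn a (Icc 0 T) → 0 < c * a x →
        ∀ᶠ t in 𝓝[≥] x, 0 < c * a t := fun {a} h1 h2 => by
      have : ContinuousWithinAt (fun t => c * a t) (Ici x) x :=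
        (continuousWithinAt_const.mul (h1 x hxI)).mono_of_mem_nhdsWithin
          (mem_of_superset (Icc_mem_nhdsGE hxT) hsub)
      exact this.eventually (lt_mem_nhds h2)
    have hupos := hpos (continuousOn_of_hasDerivWithinAt hu₁) hcpos
    have hvpos := hpos (continuousOn_of_hasDerivWithinAt hv₁)
      (by rwa [show u₁ x = v₁ x from congrArg Prod.snd hxe] at hcpos)
    have hu' : ∀ᶠ t in 𝓝[≥] x, t ∈ Ico x T ∧ u₁ t = V (u t) := by
      filter_upwards [hnear, hupos] with t ht h
      exact ⟨ht, hVeq h (hEu t ⟨hx0.trans ht.1, ht.2.le⟩)⟩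
    have hv' : ∀ᶠ t in 𝓝[≥] x, t ∈ Ico x T ∧ v₁ t = V (v t) := by
      filter_upwards [hnear, hvpos] with t ht h
      exact ⟨ht, hVeq h (hEv t ⟨hx0.trans ht.1, ht.2.le⟩)⟩
    have := eventually_eq_of_lipschitz hxT hVd
      ((continuousOn_of_hasDerivWithinAt hu).mono hsub)
      ((continuousOn_of_hasDerivWithinAt hv).mono hsub) (congrArg Prod.fst hxe)
      (hu'.mono fun t ht => ht.2 ▸ hI hu t ht.1) (hv'.mono fun t ht => ht.2 ▸ hI hv t ht.1)
    filter_upwards [this, hu', hv'] with t h1 h2 h3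
    exact Prod.ext h1 (by simp only [hw, hz, h2.2, h3.2, h1])
  · refine eventually_eq_of_lipschitz (V := fun y => (y.2, -K * signedPow q y.1)) hxT ?_
      (hwc.mono hsub) (hzc.mono hsub) hxe ?_ ?_
    · exact contDiffAt_snd.prodMk
        (contDiffAt_const.mul ((contDiffAt_signedPow q hux).comp (w x) contDiffAt_fst))
    · exact hnear.mono fun t ht => (hI hu t ht).prodMk (hI hu₁ t ht)
    · exact hnear.mono fun t ht => (hI hv t ht).prodMk (hI hv₁ t ht)

end ODE

/-! ### Eigenpairs and second order equations -/

section Eigenpairs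

variable {p q K T c ω lam : ℝ} {u u₁ u₂ : ℝ → ℝ}

lemma contDiff_two_of_hasDerivAt (h : ∀ x, HasDerivAt u (u₁ x) x)
    (h₁ : ∀ x, HasDerivAt u₁ (u₂ x) x) (h₂ : Continuous u₂) : ContDiff ℝ 2 u := by
  have e : deriv u = u₁ := funext fun x => (h x).deriv
  have e₁ : deriv u₁ = u₂ := funext fun x => (h₁ x).deriv
  rw [show (2 : WithTop ℕ∞) = 1 + 1 by norm_num, contDiff_succ_iff_deriv]
  refine ⟨fun x => (h x).differentiableAt, by simp, ?_⟩
  rw [e, contDiff_one_iff_deriv, e₁]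
  exact ⟨fun x => (h₁ x).differentiableAt, h₂⟩

lemma iteratedDerivWithin_two_of_hasDerivAt (hT : 0 < T) (h : ∀ x, HasDerivAt u (u₁ x) x)
    (h₁ : ∀ x, HasDerivAt u₁ (u₂ x) x) {x : ℝ} (hx : x ∈ Icc 0 T) :
    iteratedDerivWithin 2 u (Icc 0 T) x = u₂ x := by
  have hU := uniqueDiffOn_Icc hT
  rw [iteratedDerivWithin_succ, ← ((h₁ x).hasDerivWithinAt.derivWithin (hU x hx))]
  refine derivWithin_congr (fun y hy => ?_) ?_
  · rw [iteratedDerivWithin_one]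
    exact (h y).hasDerivWithinAt.derivWithin (hU y hy)
  · rw [iteratedDerivWithin_one]
    exact (h x).hasDerivWithinAt.derivWithin (hU x hx)

lemma hasDerivWithinAt_iteratedDerivWithin_two (hT : 0 < T)
    (h : ContDiffOn ℝ 2 u (Icc 0 T)) {x : ℝ} (hx : x ∈ Icc 0 T) :
    HasDerivWithinAt u (derivWithin u (Icc 0 T) x) (Icc 0 T) x ∧
      HasDerivWithinAt (derivWithin u (Icc 0 T)) (iteratedDerivWithin 2 u (Icc 0 T) x)
        (Icc 0 T) x := by
  have hU := uniqueDiffOn_Icc hT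
  refine ⟨(h.differentiableOn (by norm_num) x hx).hasDerivWithinAt, ?_⟩
  have h1 := h.differentiableOn_iteratedDerivWithin (m := 1) (by norm_num) hU x hx
  have h2 := h1.hasDerivWithinAt
  rw [← iteratedDerivWithin_succ] at h2
  have e : iteratedDerivWithin 1 u (Icc 0 T) = derivWithin u (Icc 0 T) :=
    iteratedDerivWithin_one
  rwa [e] at h2

/-- A solution of `u'' = -K [u]^{q-1}` with zero boundary values gives an eigenpair. -/
lemma isEigenpair_of_ode (h : p.HolderConjugate q) (hT : 0 < T) (hK : 0 < K)
    (hu : ∀ x, HasDerivAt u (u₁ x) x) (hu₁ : ∀ x, HasDerivAt u₁ (-K * signedPow q (u x)) x)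
    (h0 : u 0 = 0) (hTT : u T = 0) (hne : ∃ t ∈ Icc 0 T, u t ≠ 0) :
    IsEigenpair p q T u (K ^ p) := by
  have hc : Continuous u := continuous_iff_continuousAt.2 fun x => (hu x).continuousAt
  have hφ : Continuous fun x => signedPow q (u x) := (continuous_signedPow h.symm.lt).comp hc
  have h2 : ∀ x ∈ Icc 0 T, iteratedDerivWithin 2 u (Icc 0 T) x = -K * signedPow q (u x) :=
    fun x hx => iteratedDerivWithin_two_of_hasDerivAt hT hu hu₁ hx
  -- The conjugate powers cancel, leaving a multiple of `u`; differentiating twice more gives the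
  -- eigenvalue `K^(p-1) * K = K^p`.
  have hw : ∀ x ∈ Icc 0 T, signedPow p (iteratedDerivWithin 2 u (Icc 0 T) x) =
      -K ^ (p - 1) * u x := fun x hx => by
    rw [h2 x hx, neg_mul, signedPow_neg, signedPow_mul h.lt hK.le, signedPow_signedPow h,
      neg_mul]
  have hd : ∀ x, HasDerivAt (fun x => -K ^ (p - 1) * u x) (-K ^ (p - 1) * u₁ x) x :=
    fun x => (hu x).const_mul _
  have hd₁ : ∀ x, HasDerivAt (fun x => -K ^ (p - 1) * u₁ x)
      (-K ^ (p - 1) * (-K * signedPow q (u x))) x := fun x => (hu₁ x).const_mul _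
  refine ⟨Real.rpow_pos_of_pos hK p, hne, ?_, ?_, fun t ht => ?_, h0, hTT, ?_, ?_⟩
  · exact (contDiff_two_of_hasDerivAt hu hu₁ (continuous_const.mul hφ)).contDiffOn
  · exact (contDiff_two_of_hasDerivAt hd hd₁
      (continuous_const.mul (continuous_const.mul hφ))).contDiffOn.congr hw
  · rw [iteratedDerivWithin_congr hw ht, iteratedDerivWithin_two_of_hasDerivAt hT hd hd₁ ht,
      show p = p - 1 + 1 by ring, Real.rpow_add_one hK.ne', add_sub_cancel_right]
    ring
  · rw [h2 0 ⟨le_rfl, hT.le⟩, h0, signedPow_zero, mul_zero]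
  · rw [h2 T ⟨hT.le, le_rfl⟩, hTT, signedPow_zero, mul_zero]

/-- An eigenfunction solves the second order equation `u'' = -λ^{1/p} [u]^{q-1}`. -/
lemma IsEigenpair.hasDerivWithinAt (h : p.HolderConjugate q) (hT : 0 < T)
    (hu : IsEigenpair p q T u lam) {x : ℝ} (hx : x ∈ Icc 0 T) :
    HasDerivWithinAt u (derivWithin u (Icc 0 T) x) (Icc 0 T) x ∧
      HasDerivWithinAt (derivWithin u (Icc 0 T)) (-lam ^ (1 / p) * signedPow q (u x))
        (Icc 0 T) x := by
  have hlam := hu.lam_pos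
  have hq := h.symm.lt
  have hp := h.lt
  -- The scales are forced by symmetry: for `v = -k⁻¹ w` the two equations have the same coefficient
  -- exactly when `K * k = lam` and `k^(q-1) = K`.
  set K := lam ^ (1 / p) with hKdef
  set k := lam ^ (1 / q) with hkdef
  have hK : 0 < K := Real.rpow_pos_of_pos hlam _
  have hk : 0 < k := Real.rpow_pos_of_pos hlam _
  have hpq : 1 / p + 1 / q = 1 := by
    have := h.mul_eq_add
    field_simp
    linarith
  have hKk : K * k = lam := by
    rw [hKdef, hkdef, ← Real.rpow_add hlam, hpq, Real.rpow_one]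
  have hkK : k ^ (q - 1) = K := by
    rw [hKdef, hkdef, ← Real.rpow_mul hlam.le]
    congr 1
    field_simp at hpq ⊢
    linarith
  set w : ℝ → ℝ := fun t => signedPow p (iteratedDerivWithin 2 u (Icc 0 T) t) with hw
  have hd := fun y hy => hasDerivWithinAt_iteratedDerivWithin_two (x := y) hT hu.contDiffOn hy
  have hdw := fun y hy =>
    hasDerivWithinAt_iteratedDerivWithin_two (x := y) hT hu.contDiffOn_pow hy
  have hu₁ : ∀ y ∈ Icc 0 T, HasDerivWithinAt (derivWithin u (Icc 0 T))
      (-K * signedPow q (-k⁻¹ * w y)) (Icc 0 T) y := fun y hy => by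
    refine (hd y hy).2.congr_deriv ?_
    have h1 : iteratedDerivWithin 2 u (Icc 0 T) y = signedPow q (w y) :=
      (signedPow_signedPow h.symm _).symm
    have h2 : w y = -(k * (-k⁻¹ * w y)) := by field_simp
    rw [h1]
    nth_rw 1 [h2]
    rw [signedPow_neg, signedPow_mul hq hk.le, hkK]
    ring
  have hv₁ : ∀ y ∈ Icc 0 T, HasDerivWithinAt (fun y => -k⁻¹ * derivWithin w (Icc 0 T) y)
      (-K * signedPow q (u y)) (Icc 0 T) y := fun y hy => by
    refine ((hdw y hy).2.const_mul (-k⁻¹)).congr_deriv ?_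
    rw [hu.equation y hy, ← hKk]
    field_simp
  have heq := eqOn_of_symmetric_system hq hK (fun y hy => (hd y hy).1) hu₁
    (fun y hy => (hdw y hy).1.const_mul (-k⁻¹)) hv₁ hu.left hu.right
    (by simp [hw, hu.left_second, signedPow_zero])
    (by simp [hw, hu.right_second, signedPow_zero])
  refine ⟨(hd x hx).1, ?_⟩
  have h1 := hu₁ x hx
  rwa [show -k⁻¹ * w x = u x from (heq hx).symm] at h1

/-! ### The model solutions -/

lemma hasDerivAt_scaled_sinRS (hq : 1 < q) (c ω x : ℝ) :
    HasDerivAt (fun x => c * sinRS 2 q (ω * x)) (c * ω * deriv (sinRS 2 q) (ω * x)) x := by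
  have h1 : HasDerivAt (fun x => ω * x) ω x := by simpa using (hasDerivAt_id x).const_mul ω
  refine (((hasDerivAt_sinRS hq (ω * x)).comp x h1).const_mul c).congr_deriv ?_
  ring

lemma hasDerivAt_deriv_scaled_sinRS (hq : 1 < q) (hc : 0 < c) (ω x : ℝ) :
    HasDerivAt (fun x => c * ω * deriv (sinRS 2 q) (ω * x))
      (-(q * ω ^ 2 / 2 * c ^ (2 - q)) * signedPow q (c * sinRS 2 q (ω * x))) x := by
  have h1 : HasDerivAt (fun x => ω * x) ω x := by simpa using (hasDerivAt_id x).const_mul ω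
  refine (((hasDerivAt_deriv_sinRS hq (ω * x)).comp x h1).const_mul (c * ω)).congr_deriv ?_
  rw [signedPow_mul hq hc.le]
  have : c ^ (2 - q) * c ^ (q - 1) = c := by
    rw [← Real.rpow_add hc]
    ring_nf
    exact Real.rpow_one c
  linear_combination (q * ω ^ 2 / 2 * signedPow q (sinRS 2 q (ω * x))) * this

lemma exists_eqOn_scaled_sinRS (hq : 1 < q) (hK : 0 < K) (hT : 0 < T)
    (hu : ∀ x ∈ Icc 0 T, HasDerivWithinAt u (u₁ x) (Icc 0 T) x)
    (hu₁ : ∀ x ∈ Icc 0 T, HasDerivWithinAt u₁ (-K * signedPow q (u x)) (Icc 0 T) x)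
    (h0 : u 0 = 0) (hTT : u T = 0) (hpos : 0 < u₁ 0) :
    ∃ n : ℕ, 1 ≤ n ∧ ∃ c : ℝ, 0 < c ∧
      K = q * (piRS 2 q * n / T) ^ 2 / 2 * c ^ (2 - q) ∧
      EqOn u (fun x => c * sinRS 2 q (piRS 2 q * n / T * x)) (Icc 0 T) := by
  have hP := piRS_pos one_lt_two hq
  have hq0 : 0 < q := by linarith
  set a := u₁ 0 with ha
  -- The amplitude at which all the energy is potential: `a² = (2K/q) c^q`. The frequency `a / c`
  -- then matches the initial slope.
  set c := (q * a ^ 2 / (2 * K)) ^ (1 / q) with hcdef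
  have hc : 0 < c := by positivity
  have hcq : c ^ q = q * a ^ 2 / (2 * K) := by
    rw [hcdef, ← Real.rpow_mul (by positivity), one_div_mul_cancel hq0.ne', Real.rpow_one]
  have hKc : K = q * (a / c) ^ 2 / 2 * c ^ (2 - q) := by
    rw [Real.rpow_sub hc, hcq, Real.rpow_two]
    field_simp
  have heq : EqOn u (fun x => c * sinRS 2 q (a / c * x)) (Icc 0 T) := by
    refine eqOn_of_ode hq hK hu hu₁
      (fun x _ => (hasDerivAt_scaled_sinRS hq c (a / c) x).hasDerivWithinAt)
      (fun x _ => ?_) ?_ ?_ hpos.ne'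
    · have := (hasDerivAt_deriv_scaled_sinRS hq hc (a / c) x).hasDerivWithinAt (s := Icc 0 T)
      rwa [← hKc] at this
    · simp [h0, sinRS_zero one_lt_two hq]
    · simp only [mul_zero, deriv_sinRS_zero hq, mul_one]
      field_simp
      exact ha.symm
  have hS : sinRS 2 q (a / c * T) = 0 := by
    have := heq (right_mem_Icc.2 hT.le)
    rw [hTT] at this
    exact (mul_eq_zero.1 this.symm).resolve_left hc.ne'
  obtain ⟨n, hn⟩ := exists_nat_mul_of_sinRS_eq_zero one_lt_two hq (by positivity) hS
  have hω : a / c = piRS 2 q * n / T := by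
    rw [eq_div_iff hT.ne', hn, mul_comm]
  refine ⟨n, Nat.one_le_iff_ne_zero.2 ?_, c, hc, hω ▸ hKc, hω ▸ heq⟩
  rintro rfl
  have : 0 < a / c * T := by positivity
  simp [hn] at this

/-- A negative initial slope is handled by passing to `-u`; a zero one means zero energy, which
contradicts nontriviality. -/
lemma exists_eqOn_or_eqOn_neg_scaled_sinRS (hq : 1 < q) (hK : 0 < K) (hT : 0 < T)
    (hu : ∀ x ∈ Icc 0 T, HasDerivWithinAt u (u₁ x) (Icc 0 T) x)
    (hu₁ : ∀ x ∈ Icc 0 T, HasDerivWithinAt u₁ (-K * signedPow q (u x)) (Icc 0 T) x)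
    (h0 : u 0 = 0) (hTT : u T = 0) (hne : ∃ t ∈ Icc 0 T, u t ≠ 0) :
    ∃ n : ℕ, 1 ≤ n ∧ ∃ c : ℝ, 0 < c ∧
      K = q * (piRS 2 q * n / T) ^ 2 / 2 * c ^ (2 - q) ∧
      (EqOn u (fun x => c * sinRS 2 q (piRS 2 q * n / T * x)) (Icc 0 T) ∨
        EqOn u (fun x => -(c * sinRS 2 q (piRS 2 q * n / T * x))) (Icc 0 T)) := by
  have hq0 : 0 < q := by linarith
  rcases lt_trichotomy (u₁ 0) 0 with h | h | h
  · obtain ⟨n, hn, c, hc, h1, h2⟩ := exists_eqOn_scaled_sinRS (u := fun x => -u x)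
      (u₁ := fun x => -u₁ x) hq hK hT (fun x hx => (hu x hx).neg)
      (fun x hx => (hu₁ x hx).neg.congr_deriv (by rw [signedPow_neg]; ring))
      (by simp [h0]) (by simp [hTT]) (by simpa using h)
    refine ⟨n, hn, c, hc, h1, Or.inr fun x hx => ?_⟩
    exact neg_eq_iff_eq_neg.1 (h2 hx)
  · obtain ⟨t, ht, hut⟩ := hne
    have h1 := energy_eq hq hu hu₁ ht
    rw [h, h0, abs_zero, Real.zero_rpow hq0.ne'] at h1
    have : 0 < |u t| ^ q := Real.rpow_pos_of_pos (abs_pos.2 hut) q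
    have : 0 < 2 * K / q * |u t| ^ q := by positivity
    nlinarith [sq_nonneg (u₁ t)]
  · obtain ⟨n, hn, c, hc, h1, h2⟩ := exists_eqOn_scaled_sinRS hq hK hT hu hu₁ h0 hTT h
    exact ⟨n, hn, c, hc, h1, Or.inl h2⟩

/-! ### The listed eigenfunctions and eigenvalues -/

lemma eigenfunctionN_eq (q T : ℝ) (n : ℕ) (c : ℝ) :
    eigenfunctionN q T n c = fun x => c * sinRS 2 q (piRS 2 q * n / T * x) := by
  funext x
  rw [eigenfunctionN, div_mul_eq_mul_div]

lemma eigenvalueN_eq (h : p.HolderConjugate q) (hT : 0 < T) (n : ℕ) (c : ℝ) :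
    eigenvalueN p q T n c =
      (q * piRS 2 q ^ 2 * (n : ℝ) ^ 2 / (2 * T ^ 2)) ^ p * c ^ (p - q) := by
  have hq := h.symm.lt
  have hP := piRS_pos one_lt_two hq
  rw [eigenvalueN, piRS_holderConjugate h, Real.rpow_mul hT.le, Real.rpow_two,
    ← Real.div_rpow (by positivity) (by positivity)]
  congr 2
  field_simp

/-- Exhibits the eigenvalue as `K^p` for the coefficient `K` of the second order equation; the
exponents match because `(2 - q) * p = p - q`. -/
lemma eigenvalueN_eq_rpow (h : p.HolderConjugate q) (hT : 0 < T) (n : ℕ) (hc : 0 < c) :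
    eigenvalueN p q T n c = (q * (piRS 2 q * n / T) ^ 2 / 2 * c ^ (2 - q)) ^ p := by
  have hq := h.symm.lt
  rw [eigenvalueN_eq h hT, Real.mul_rpow (by positivity) (by positivity), ← Real.rpow_mul hc.le]
  congr 2
  · field_simp
  · have := h.mul_eq_add
    linarith

lemma isEigenpair_eigenfunctionN (h : p.HolderConjugate q) (hT : 0 < T) {n : ℕ} (hn : 1 ≤ n)
    (hc : 0 < c) : IsEigenpair p q T (eigenfunctionN q T n c) (eigenvalueN p q T n c) := by
  have hq := h.symm.lt
  have hP := piRS_pos one_lt_two hq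
  have hn0 : (0 : ℝ) < n := by exact_mod_cast hn
  rw [eigenvalueN_eq_rpow h hT n hc, eigenfunctionN_eq]
  refine isEigenpair_of_ode h hT (by positivity) (hasDerivAt_scaled_sinRS hq c _)
    (hasDerivAt_deriv_scaled_sinRS hq hc _) ?_ ?_ ?_
  · simp [sinRS_zero one_lt_two hq]
  · have := sinRS_add_nat_mul one_lt_two hq 0 n
    rw [zero_add, sinRS_zero one_lt_two hq, mul_zero] at this
    rw [div_mul_cancel₀ _ hT.ne', mul_comm (piRS 2 q), this, mul_zero]
  · refine ⟨T / (2 * n), ⟨by positivity, ?_⟩, ?_⟩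
    · rw [div_le_iff₀ (by positivity)]
      have : (1 : ℝ) ≤ n := by exact_mod_cast hn
      nlinarith
    · have : piRS 2 q * n / T * (T / (2 * n)) = piRS 2 q / 2 := by field_simp
      simp [this, sinRS_piRS_div_two one_lt_two hq, hc.ne']

lemma derivWithin_eigenfunctionN (hq : 1 < q) (hT : 0 < T) (n : ℕ) (c : ℝ) :
    derivWithin (eigenfunctionN q T n c) (Icc 0 T) 0 = c * (piRS 2 q * n / T) := by
  rw [eigenfunctionN_eq, (hasDerivAt_scaled_sinRS hq c _ 0).hasDerivWithinAt.derivWithin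
    (uniqueDiffOn_Icc hT 0 (left_mem_Icc.2 hT.le)), mul_zero, deriv_sinRS_zero hq, mul_one]

lemma derivWithin_eigenfunctionN_pos (hq : 1 < q) (hT : 0 < T) {n : ℕ} (hn : 1 ≤ n)
    (hc : 0 < c) : 0 < derivWithin (eigenfunctionN q T n c) (Icc 0 T) 0 := by
  have hP := piRS_pos one_lt_two hq
  have hn0 : (0 : ℝ) < n := by exact_mod_cast hn
  rw [derivWithin_eigenfunctionN hq hT]
  positivity

lemma IsEigenpair.exists_eigenfunctionN (h : p.HolderConjugate q) (hT : 0 < T)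
    (hu : IsEigenpair p q T u lam) :
    ∃ n : ℕ, 1 ≤ n ∧ ∃ c : ℝ, 0 < c ∧ lam = eigenvalueN p q T n c ∧
      (EqOn u (eigenfunctionN q T n c) (Icc 0 T) ∨
        EqOn u (fun x => -eigenfunctionN q T n c x) (Icc 0 T)) := by
  have hlam := hu.lam_pos
  obtain ⟨n, hn, c, hc, h1, h2⟩ := exists_eqOn_or_eqOn_neg_scaled_sinRS h.symm.lt
    (Real.rpow_pos_of_pos hlam (1 / p)) hT (fun x hx => (hu.hasDerivWithinAt h hT hx).1)
    (fun x hx => (hu.hasDerivWithinAt h hT hx).2) hu.left hu.right hu.nontrivial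
  refine ⟨n, hn, c, hc, ?_, by rwa [eigenfunctionN_eq]⟩
  rw [eigenvalueN_eq_rpow h hT n hc, ← h1, ← Real.rpow_mul hlam.le,
    one_div_mul_cancel h.ne_zero, Real.rpow_one]

/-! ### Counting sign changes -/

lemma HasAlternation.congr {v : ℝ → ℝ} {S : Set ℝ} {m : ℕ} (h : HasAlternation u S m)
    (huv : EqOn u v S) : HasAlternation v S m := by
  obtain ⟨x, hx, hxS, hx'⟩ := h
  refine ⟨x, hx, hxS, fun i => ?_⟩
  rw [← huv (hxS _), ← huv (hxS _)]
  exact hx' i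

lemma neg_one_pow_floor_mul_sinRS_nonneg (hq : 1 < q) {x : ℝ} (hx : 0 ≤ x) :
    0 ≤ (-1) ^ ⌊x / piRS 2 q⌋₊ * sinRS 2 q x := by
  have hP := piRS_pos one_lt_two hq
  set k := ⌊x / piRS 2 q⌋₊ with hk
  have h1 : k * piRS 2 q ≤ x := (le_div_iff₀ hP).1 (Nat.floor_le (div_nonneg hx hP.le))
  have h2 : x < (k + 1) * piRS 2 q := (div_lt_iff₀ hP).1 (Nat.lt_floor_add_one (x / piRS 2 q))
  have h3 := sinRS_add_nat_mul one_lt_two hq (x - k * piRS 2 q) k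
  rw [sub_add_cancel] at h3
  rw [h3, ← mul_assoc, ← mul_pow, neg_one_mul, neg_neg, one_pow, one_mul]
  rcases h1.eq_or_lt with h4 | h4
  · rw [h4, sub_self, sinRS_zero one_lt_two hq]
  · exact (sinRS_pos one_lt_two hq ⟨by linarith, by linarith⟩).le

/-- Two points in the same half-wave never have opposite strict signs, so half-wave indices strictly
increase along an alternation; they lie in `{0, ..., n-1}`, which forces `m < n`. -/
lemma hasAlternation_eigenfunctionN_iff (hq : 1 < q) (hT : 0 < T) {n : ℕ} (hn : 1 ≤ n)
    (hc : 0 < c) (m : ℕ) :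
    HasAlternation (eigenfunctionN q T n c) (Ioo 0 T) m ↔ m < n := by
  have hP := piRS_pos one_lt_two hq
  have hn0 : (0 : ℝ) < n := by exact_mod_cast hn
  constructor
  · rintro ⟨x, hx, hxI, hx'⟩
    set j : Fin (m + 1) → ℕ := fun i => ⌊piRS 2 q * n * x i / T / piRS 2 q⌋₊ with hj
    have hlt : ∀ i : Fin m, j i.castSucc < j i.succ := fun i => by
      have hle : j i.castSucc ≤ j i.succ := by
        have := (hx (Fin.castSucc_lt_succ (i := i))).le
        apply Nat.floor_le_floor
        gcongr
      refine lt_of_le_of_ne hle fun he => ?_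
      have h0 : ∀ i, 0 ≤ piRS 2 q * n * x i / T := fun i => by
        have := (hxI i).1
        positivity
      have h1 := neg_one_pow_floor_mul_sinRS_nonneg hq (h0 i.castSucc)
      have h2 := neg_one_pow_floor_mul_sinRS_nonneg hq (h0 i.succ)
      change 0 ≤ (-1) ^ j i.castSucc * _ at h1
      change 0 ≤ (-1) ^ j i.succ * _ at h2
      rw [he] at h1
      have h3 := mul_nonneg h1 h2
      rw [mul_mul_mul_comm, ← mul_pow, neg_one_mul, neg_neg, one_pow, one_mul] at h3
      have h4 := hx' i
      rw [eigenfunctionN, eigenfunctionN, mul_mul_mul_comm] at h4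
      exact absurd (mul_nonneg (mul_pos hc hc).le h3) (not_le.2 h4)
    have hind : ∀ i (hi : i < m + 1), i ≤ j ⟨i, hi⟩ := by
      intro i
      induction i with
      | zero => exact fun _ => Nat.zero_le _
      | succ i ih =>
        intro hi
        exact (ih (by omega)).trans_lt (hlt ⟨i, by omega⟩)
    refine (hind m (Nat.lt_succ_self m)).trans_lt ?_
    have hI := hxI ⟨m, Nat.lt_succ_self m⟩
    have hI1 := hI.1
    rw [hj, Nat.floor_lt (by positivity), div_lt_iff₀ hP, div_lt_iff₀ hT]
    have := mul_lt_mul_of_pos_left hI.2 (mul_pos hP hn0)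
    linarith
  · intro hm
    -- The midpoints of the half-waves, where the sine is `±1`, realize the alternation.
    have hval : ∀ k : ℕ, eigenfunctionN q T n c (T * (2 * k + 1) / (2 * n)) = c * (-1) ^ k :=
      fun k => by
        have e : piRS 2 q * n * (T * (2 * k + 1) / (2 * n)) / T =
            piRS 2 q / 2 + k * piRS 2 q := by
          field_simp
          ring
        rw [eigenfunctionN, e, sinRS_add_nat_mul one_lt_two hq, sinRS_piRS_div_two one_lt_two hq,
          mul_one]
    refine ⟨fun i => T * (2 * ((i : ℕ) : ℝ) + 1) / (2 * n), fun i k hik => ?_, fun i => ?_,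
      fun i => ?_⟩
    · have : ((i : ℕ) : ℝ) < ((k : ℕ) : ℝ) := by exact_mod_cast hik
      beta_reduce
      gcongr
    · refine ⟨by positivity, ?_⟩
      have : ((i : ℕ) : ℝ) + 1 ≤ n := by exact_mod_cast (by omega : (i : ℕ) + 1 ≤ n)
      rw [div_lt_iff₀ (by positivity)]
      exact mul_lt_mul_of_pos_left (by linarith) hT
    · have e : c * (-1) ^ (i : ℕ) * (c * (-1) ^ ((i : ℕ) + 1)) = -(c * c) := by
        rw [mul_mul_mul_comm, ← pow_add, show (i : ℕ) + (i + 1) = 2 * i + 1 by ring, pow_succ,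
          pow_mul]
        norm_num
      rw [hval, hval, Fin.val_castSucc, Fin.val_succ, e]
      exact neg_neg_of_pos (mul_pos hc hc)

lemma changesSignExactly_eigenfunctionN (hq : 1 < q) (hT : 0 < T) {n : ℕ} (hn : 1 ≤ n)
    (hc : 0 < c) : ChangesSignExactly (eigenfunctionN q T n c) (Ioo 0 T) (n - 1) := by
  rw [ChangesSignExactly, hasAlternation_eigenfunctionN_iff hq hT hn hc,
    hasAlternation_eigenfunctionN_iff hq hT hn hc]
  omega

lemma IsEigenpair.exists_of_changesSignExactly (h : p.HolderConjugate q) (hT : 0 < T)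
    (hu : IsEigenpair p q T u lam) (hpos : 0 < derivWithin u (Icc 0 T) 0) {n : ℕ} (hn : 1 ≤ n)
    (hch : ChangesSignExactly u (Ioo 0 T) (n - 1)) :
    ∃ c : ℝ, 0 < c ∧ lam = eigenvalueN p q T n c ∧
      EqOn u (eigenfunctionN q T n c) (Icc 0 T) := by
  have hq := h.symm.lt
  obtain ⟨m, hm, c, hc, hlam, heq⟩ := hu.exists_eigenfunctionN h hT
  have h0 : (0 : ℝ) ∈ Icc 0 T := left_mem_Icc.2 hT.le
  have hpos' := derivWithin_eigenfunctionN_pos hq hT hm hc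
  rcases heq with heq | heq
  · have hI := heq.mono Ioo_subset_Icc_self
    have h1 := (hasAlternation_eigenfunctionN_iff hq hT hm hc _).1 (hch.1.congr hI)
    have h2 : ¬n - 1 + 1 < m := fun hlt => hch.2
      (((hasAlternation_eigenfunctionN_iff hq hT hm hc _).2 hlt).congr hI.symm)
    obtain rfl : m = n := by omega
    exact ⟨c, hc, hlam, heq⟩
  -- The minus sign is excluded by the slope at `0`.
  · rw [derivWithin_congr heq (heq h0), derivWithin.fun_neg] at hpos
    linarith

/-- Conjugate exponents coincide only at `2`, so `p - q ≠ 0` and `c ↦ c^(p-q)` is injective on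
positive reals. -/
lemma eigenvalueN_injOn (h : p.HolderConjugate q) (hp2 : p ≠ 2) (hT : 0 < T) {n : ℕ}
    (hn : 1 ≤ n) : InjOn (eigenvalueN p q T n) (Ioi 0) := by
  intro c hc d hd hcd
  have hq := h.symm.lt
  have hP := piRS_pos one_lt_two hq
  have hn0 : (0 : ℝ) < n := by exact_mod_cast hn
  rw [eigenvalueN_eq h hT, eigenvalueN_eq h hT] at hcd
  have hpq : p - q ≠ 0 := fun hpq => hp2 <| by
    have h1 := h.mul_eq_add
    have h2 : q = p := by linarith
    rw [h2] at h1
    have h3 : p * (p - 2) = 0 := by linarith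
    have := (mul_eq_zero.1 h3).resolve_left h.ne_zero
    linarith
  have h1 := mul_left_cancel₀ (by positivity) hcd
  exact (Real.rpow_left_inj (le_of_lt hc) (le_of_lt hd) hpq).1 h1

end Eigenpairs

end BiharmonicEigen

end

theorem mainTheorem6 (p p' t0 : ℝ) (hp : p.HolderConjugate p') (ht0 : 0 < t0) :
    -- the two expressions for the eigenvalue agree
    (∀ n : ℕ, 1 ≤ n → ∀ c : ℝ, 0 < c →
      BiharmonicEigen.eigenvalueN p p' t0 n c =
        (p' * BiharmonicEigen.piRS 2 p' ^ 2 * (n : ℝ) ^ 2 / (2 * t0 ^ 2)) ^ p * c ^ (p - p')) ∧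
    -- every listed pair is an eigenpair, with the stated sign properties
    (∀ n : ℕ, 1 ≤ n → ∀ c : ℝ, 0 < c →
      BiharmonicEigen.IsEigenpair p p' t0 (BiharmonicEigen.eigenfunctionN p' t0 n c)
          (BiharmonicEigen.eigenvalueN p p' t0 n c) ∧
        0 < derivWithin (BiharmonicEigen.eigenfunctionN p' t0 n c) (Set.Icc 0 t0) 0 ∧
        BiharmonicEigen.ChangesSignExactly (BiharmonicEigen.eigenfunctionN p' t0 n c)
          (Set.Ioo 0 t0) (n - 1)) ∧
    -- up to the sign of the eigenfunction, there are no other eigenpairs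
    (∀ (u : ℝ → ℝ) (lam : ℝ), BiharmonicEigen.IsEigenpair p p' t0 u lam →
      ∃ n : ℕ, 1 ≤ n ∧ ∃ c : ℝ, 0 < c ∧ lam = BiharmonicEigen.eigenvalueN p p' t0 n c ∧
        (Set.EqOn u (BiharmonicEigen.eigenfunctionN p' t0 n c) (Set.Icc 0 t0) ∨
          Set.EqOn u (fun x => -BiharmonicEigen.eigenfunctionN p' t0 n c x) (Set.Icc 0 t0))) ∧
    -- positive derivative at zero and `n - 1` sign changes single out the index `n`
    (∀ n : ℕ, 1 ≤ n → ∀ (u : ℝ → ℝ) (lam : ℝ), BiharmonicEigen.IsEigenpair p p' t0 u lam →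
      0 < derivWithin u (Set.Icc 0 t0) 0 →
      BiharmonicEigen.ChangesSignExactly u (Set.Ioo 0 t0) (n - 1) →
      ∃ c : ℝ, 0 < c ∧ lam = BiharmonicEigen.eigenvalueN p p' t0 n c ∧
        Set.EqOn u (BiharmonicEigen.eigenfunctionN p' t0 n c) (Set.Icc 0 t0)) ∧
    -- for `p ≠ 2` the eigenfunction is then determined by the eigenvalue
    (p ≠ 2 → ∀ n : ℕ, 1 ≤ n → ∀ c : ℝ, 0 < c → ∀ u : ℝ → ℝ,
      BiharmonicEigen.IsEigenpair p p' t0 u (BiharmonicEigen.eigenvalueN p p' t0 n c) →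
      0 < derivWithin u (Set.Icc 0 t0) 0 →
      BiharmonicEigen.ChangesSignExactly u (Set.Ioo 0 t0) (n - 1) →
      Set.EqOn u (BiharmonicEigen.eigenfunctionN p' t0 n c) (Set.Icc 0 t0)) := by
  have hq := hp.symm.lt
  refine ⟨fun n _ c _ => BiharmonicEigen.eigenvalueN_eq hp ht0 n c, fun n hn c hc =>
    ⟨BiharmonicEigen.isEigenpair_eigenfunctionN hp ht0 hn hc,
      BiharmonicEigen.derivWithin_eigenfunctionN_pos hq ht0 hn hc,
      BiharmonicEigen.changesSignExactly_eigenfunctionN hq ht0 hn hc⟩,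
    fun u lam hu => hu.exists_eigenfunctionN hp ht0,
    fun n hn u lam hu hpos hch => hu.exists_of_changesSignExactly hp ht0 hpos hn hch,
    fun hp2 n hn c hc u hu hpos hch => ?_⟩
  obtain ⟨d, hd, hlam, heq⟩ := hu.exists_of_changesSignExactly hp ht0 hpos hn hch
  rwa [BiharmonicEigen.eigenvalueN_injOn hp hp2 ht0 hn hc hd hlam]
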